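/- Let $n\ge 1$. A \emph{preference function} on $n$ cars is a map $f:\{1,\dots,n\}\to\{1,\dots,n\}$; it is a \emph{parking function} if $|f^{-1}(\{1,\dots,k\})|\ge k$ for all $1\le k\le n$. Write $\mathcal{P}ref_n$ and $\mathcal{PF}_n$ for the sets of preference and parking functions. Draw $f$ in an $n\times n$ lattice by placing one car per row, filling rows from bottom to top, column by column from left to right: car $c$ lies in column $f(c)$, and cars in the same column increase from bottom to top. If car $c$ lies in row $r$, it is in diagonal $r-f(c)$ (a cell on the line $y=x+d$ is in diagonal $d$). Define: - the \emph{deviation} $l(f)$ is the largest $l$ such that diagonal $-l$ contains a car, and $\operatorname{area}(f)=\sum_c (d(c)+l(f))$, where $d(c)$ is the diagonal of car $c$; - $\operatorname{dinv}(f)$ is the number of pairs of cars $a<b$ in the same diagonal with $a$ further left than $b$, plus the number of pairs of cars $a<b$ with $d(b)=d(a)+1$ and $a$ in a column strictly to the right of $b$, plus the number of cars in negative diagonals; - the \emph{word} $\sigma(f)$ lists the cars from the highest to the lowest diagonal and from right to left within each diagonal, and $\operatorname{ides}(f)$ is the set of $i\in\{1,\dots,n-1\}$ such that $i+1$ comes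 before $i$ in $\sigma(f)$; - the \emph{diagonal word} $\operatorname{diagword}(f)$ lists the cars from the highest to the lowest diagonal and in increasing order within each diagonal. For $S\subseteq\{1,\dots,n-1\}$ let $$Q_S(x_1,\dots,x_n)=\sum_{\substack{1\le a_1\le\dots\le a_n\le n\\ i\in S\Rightarrow a_i<a_{i+1}}}x_{a_1}\cdots x_{a_n}$$ be Gessel's fundamental quasi-symmetric function, and let $[m]_q=1+q+\dots+q^{m-1}$. Let $\tau\in S_n$, and let $k$ be the length of its last run (the longest increasing final segment of $\tau_1\tau_2\cdots\tau_n$). Then, as polynomials in $x_1,\dots,x_n$ over $\mathbb{Q}(q,t)$, $$\sum_{\substack{f\in\mathcal{P}ref_n\\ \operatorname{diagword}(f)=\tau}} t^{\operatorname{area}(f)}q^{\operatorname{dinv}(f)}Q_{\operatorname{ides}(f)}=\frac{[n]_q}{[k]_q}\sum_{\substack{f\in\mathcal{PF}_n\\ \operatorname{diagword}(f)=\tau}} t^{\operatorname{area}(f)}q^{\operatorname{dinv}(f)}Q_{\operatorname{ides}(f)}.$$ -/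

import Mathlib

open Finset

namespace SquarePaths

/-! Cars, spots, rows, columns and positions of words are all numbered from `0`, so that the set
`{1, …, n}` is represented by `Fin n`. A permutation `τ : Equiv.Perm (Fin n)` is read in one-line
notation, as the word `τ 0, τ 1, …, τ (n - 1)`. -/

variable {n : ℕ}

/-- A preference function on `n` cars: car `c` prefers spot `f c`. In the associated labelled
square path, car `c` lies in column `f c`. -/
abbrev PrefFun (n : ℕ) : Type := Fin n → Fin n

/-- A parking function: for each `k`, at least `k` cars prefer one of the first `k` spots. -/
def IsParking (f : PrefFun n) : Prop :=
  ∀ k ≤ n, k ≤ #{c : Fin n | (f c : ℕ) < k}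

instance : DecidablePred (IsParking (n := n)) := fun f =>
  inferInstanceAs (Decidable (∀ k ≤ n, k ≤ #{c : Fin n | (f c : ℕ) < k}))

/-- The row of car `c` in the labelled path: the rows are filled from bottom to top, column by
column from left to right, in increasing order of the cars within each column. -/
def row (f : PrefFun n) (c : Fin n) : ℕ :=
  #{c' : Fin n | f c' < f c ∨ (f c' = f c ∧ c' < c)}

/-- The diagonal of car `c`: it is `k` if the cell of `c` lies on the diagonal `y = x + k`. -/
def diag (f : PrefFun n) (c : Fin n) : ℤ :=
  (row f c : ℤ) - (f c : ℤ)

/-- The deviation: the largest `l` such that some car lies in diagonal `-l`. (The car in the bottom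
row lies in a diagonal `≤ 0`, so that nothing is lost by truncating at `0`.) -/
def deviation (f : PrefFun n) : ℕ :=
  univ.sup fun c : Fin n => (-diag f c).toNat

/-- The area: a car in diagonal `k` contributes `k + l`, where `l` is the deviation. Every term is
nonnegative, by the definition of the deviation. -/
def area (f : PrefFun n) : ℕ :=
  ∑ c : Fin n, (diag f c + (deviation f : ℤ)).toNat

/-- Pairs of cars in the same diagonal, the smaller one being further left. -/
def primaryDinv (f : PrefFun n) : ℕ :=
  #{p : Fin n × Fin n | p.1 < p.2 ∧ diag f p.1 = diag f p.2 ∧ f p.1 < f p.2}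

/-- Pairs of cars in adjacent diagonals, the smaller one being in the lower diagonal and further
right. -/
def secondaryDinv (f : PrefFun n) : ℕ :=
  #{p : Fin n × Fin n | p.1 < p.2 ∧ diag f p.2 = diag f p.1 + 1 ∧ f p.2 < f p.1}

/-- Cars strictly below the main diagonal. -/
def tertiaryDinv (f : PrefFun n) : ℕ :=
  #{c : Fin n | diag f c < 0}

/-- The number of diagonal inversions. -/
def dinv (f : PrefFun n) : ℕ :=
  primaryDinv f + secondaryDinv f + tertiaryDinv f

/-- The word `σ(f)`: the cars are read from the highest to the lowest diagonal and from right to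
left within each diagonal. -/
def word (f : PrefFun n) : Equiv.Perm (Fin n) :=
  Tuple.sort fun c : Fin n => toLex (-diag f c, -(f c : ℤ))

/-- The diagonal word: the cars are listed from the highest to the lowest diagonal and in increasing
order within each diagonal. -/
def diagWord (f : PrefFun n) : Equiv.Perm (Fin n) :=
  Tuple.sort fun c : Fin n => toLex (-diag f c, c)

/-- The descent set of the inverse of `σ`: all `i` such that `i + 1` comes before `i` in the
word `σ`. -/
def invDescents (σ : Equiv.Perm (Fin n)) : Finset (Fin n) :=
  {i : Fin n | ∃ h : (i : ℕ) + 1 < n, σ.symm ⟨i + 1, h⟩ < σ.symm i}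

/-- `ides(f)`, the inverse descent set of the word of `f`. -/
def ides (f : PrefFun n) : Finset (Fin n) :=
  invDescents (word f)

/-- The length of the last run of `τ`: the number of positions from which on the one-line notation
of `τ` is increasing up to its end. -/
def lastRunLength (τ : Equiv.Perm (Fin n)) : ℕ :=
  #{i : Fin n | ∀ j k : Fin n, i ≤ j → j < k → τ j < τ k}

/-- Weakly increasing sequences of `n` indices that increase strictly after each position
in `S`. -/
def fundamentalIndices (S : Finset (Fin n)) : Finset (Fin n → Fin n) :=
  {a : Fin n → Fin n |
    (∀ i j : Fin n, i ≤ j → a i ≤ a j) ∧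
      ∀ i ∈ S, ∀ h : (i : ℕ) + 1 < n, a i < a ⟨i + 1, h⟩}

/-- Gessel's fundamental quasi-symmetric function `Q_S(x_1, …, x_n)` of degree `n`. -/
noncomputable def fundamentalQSym (K : Type*) [CommSemiring K] (S : Finset (Fin n)) :
    MvPolynomial (Fin n) K :=
  ∑ a ∈ fundamentalIndices S, ∏ i : Fin n, MvPolynomial.X (a i)

/-- The `q`-integer `[m]_q = 1 + q + ⋯ + q ^ (m - 1)`. -/
def qInt {K : Type*} [CommSemiring K] (q : K) (m : ℕ) : K :=
  ∑ i ∈ range m, q ^ i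

/-- The field `ℚ(q, t)` of rational functions in two indeterminates. -/
abbrev RatQT : Type := FractionRing (MvPolynomial (Fin 2) ℚ)

/-- The indeterminate `q`. -/
noncomputable def q : RatQT := algebraMap (MvPolynomial (Fin 2) ℚ) RatQT (MvPolynomial.X 0)

/-- The indeterminate `t`. -/
noncomputable def t : RatQT := algebraMap (MvPolynomial (Fin 2) ℚ) RatQT (MvPolynomial.X 1)

/-- The term `t ^ area(f) q ^ dinv(f) Q_{ides(f)}`, a polynomial in `x_1, …, x_n`
over `ℚ(q, t)`. -/
noncomputable def term (f : PrefFun n) : MvPolynomial (Fin n) RatQT :=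
  MvPolynomial.C (t ^ area f * q ^ dinv f) * fundamentalQSym RatQT (ides f)

end SquarePaths

/-! Read the cars of a path in row order. A word of cars with prescribed levels comes from a path
exactly when the level rises by at most one at each step, the label rises whenever the level does,
the first level is at most 0 and the last at least 0. If the diagonal word is τ, the diagonals are
the runs of τ (`diagWord_eq_iff`): `diag f` is `level τ` minus the deviation `l`. So the area
depends on τ alone, and `l = 0` gives the parking functions.

Fix `l` and build the words by inserting cars from the main diagonal upwards, on each level from the
largest car to the smallest. A car with `k` admissible places contributes `[k]_q`; negative levels
are treated by rotating the path by 180°. Hence the sum over `q` is a product of `q`-integers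
(`levelSum_eq_levelProd`). Raising `l` by one affects only the factors of two adjacent levels, and
`qFact_mul_prod_shift` shows that the sum changes by `[a_{l+1}] / [a_l]`, where `a_l` is the number
of cars on level `l`. Together with the cars in negative diagonals, deviation `l` contributes `q ^
(a_0 + ⋯ + a_{l-1}) [a_l] / [a_0]` times the parking sum. Summing over `l` gives `[n] / [a_0]`, and
`a_0` is the length of the last run (`sum_dinv_diagWord`).

For the quasi-symmetric functions, call a maximal interval of labels on one level a block. Permuting
cars inside blocks changes neither the diagonals nor the inversions between blocks, and `ides`
depends only on the levels and on the left-to-right order within blocks. Averaged over these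
permutations, the quotient of the weighted by the unweighted sum is thus the same for every `f` with
diagonal word τ, so the identity of `q`-counts lifts (`sum_mul_sum_comm`). -/

namespace SquarePaths

/-! ### Words of cars in row order, and insertion of a car. -/

section Words

variable {α : Type*} (v d : α → ℤ)

/-- Consecutive cars `x`, `y` (in row order) of a labelled path with levels `d` and labels `v`. -/
def Step (x y : α) : Prop := d y ≤ d x + 1 ∧ (d y = d x + 1 → v x < v y)

/-- The words which list the cars of a labelled path from `(0, 0)` to `(n, n)` in row order. -/
def IsLevelWord (w : List α) : Prop :=
  (∀ x ∈ w.head?, d x ≤ 0) ∧ w.IsChain (Step v d) ∧ ∀ x ∈ w.getLast?, 0 ≤ d x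

/-- The pairs that contribute to the primary or secondary diagonal inversions, provided that `x`
comes before `y`. -/
def Inverted (x y : α) : Prop := (d x = d y ∧ v x < v y) ∨ (d x = d y + 1 ∧ v y < v x)

open Classical in
/-- The number of pairs of entries of a word, in this order, which satisfy a relation. -/
noncomputable def pairCount (T : α → α → Prop) : List α → ℕ
  | [] => 0
  | x :: w => w.countP (fun y => T x y) + pairCount T w

open Classical in
theorem pairCount_insert (T : α → α → Prop) (c : α) (l₁ l₂ : List α) :
    pairCount T (l₁ ++ c :: l₂) = pairCount T (l₁ ++ l₂) + l₁.countP (fun x => T x c) +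
      l₂.countP (fun y => T c y) := by
  induction l₁ with
  | nil => simp [pairCount]; omega
  | cons x l ih =>
    simp only [List.cons_append, pairCount, ih, List.countP_append, List.countP_cons]
    omega

open Classical in
theorem pairCount_reverse (T : α → α → Prop) (w : List α) :
    pairCount T w.reverse = pairCount (fun x y => T y x) w := by
  induction w with
  | nil => rfl
  | cons x l ih =>
    rw [List.reverse_cons, pairCount_insert, List.append_nil, ih]
    simp [pairCount]; omega

variable {v d}

theorem inverted_neg (x y : α) : Inverted (-v) (-d) x y ↔ Inverted v d y x := by
  simp only [Inverted, Pi.neg_apply]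
  constructor <;> rintro (h | h) <;> [left; right; left; right] <;> constructor <;> omega

/-- Rotating the path by 180° reverses the word and negates levels and labels. This exchanges the
levels above and below the main diagonal. -/
theorem isLevelWord_reverse_neg (w : List α) :
    IsLevelWord (-v) (-d) w.reverse ↔ IsLevelWord v d w := by
  have h : (fun a b => Step (-v) (-d) b a) = Step v d := by
    funext x y
    simp only [Step, Pi.neg_apply, eq_iff_iff]
    constructor <;> rintro ⟨h₁, h₂⟩ <;> constructor <;> intros <;> try omega
  simp only [IsLevelWord, List.head?_reverse, List.getLast?_reverse, List.isChain_reverse, h,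
    Pi.neg_apply, Left.neg_nonpos_iff, Left.nonneg_neg_iff]
  tauto

/-- The entries of a word after which a new smallest car `c` of the top level may be inserted. -/
def Precedes (v d : α → ℤ) (c x : α) : Prop := d x = d c ∨ (d x = d c - 1 ∧ v x < v c)

/-- The car `c` has the smallest label on the top level of the path, which is positive unless the
path has only one level. -/
structure IsTopMin (v d : α → ℤ) (c : α) (s : Set α) : Prop where
  le : ∀ x ∈ s, d x ≤ d c
  lt : ∀ x ∈ s, d x = d c → v c < v x
  pos : 0 < d c ∨ d c = 0 ∧ ∀ x ∈ s, d x = 0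

/-- No rise can follow a car of top level, so only the entry before `c` restricts its place.
Deleting `c` is harmless because a rise to a top car `y` over the gap ends at a label above that of
`c`. If `c` is last on a positive level, its predecessor is still on a level at least 0. -/
theorem isLevelWord_insert {c : α} {l₁ l₂ : List α} (h : IsTopMin v d c {x | x ∈ l₁ ++ l₂}) :
    IsLevelWord v d (l₁ ++ c :: l₂) ↔ IsLevelWord v d (l₁ ++ l₂) ∧
      (l₁ = [] → d c ≤ 0) ∧ ∀ x ∈ l₁.getLast?, Precedes v d c x := by
  obtain ⟨hle, hlt, hpos⟩ := h
  simp only [Set.mem_ofPred_eq, List.mem_append] at hle hlt hpos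
  rcases List.eq_nil_or_concat l₁ with rfl | ⟨l, x, rfl⟩
  · rcases l₂ with _ | ⟨y, l₂⟩
    · simp [IsLevelWord]; omega
    · have h1 := hle y (by simp)
      have h2 := hlt y (by simp)
      have h3 : 0 < d c ∨ d c = 0 ∧ d y = 0 := hpos.imp_right fun h => ⟨h.1, h.2 y (by simp)⟩
      simp only [IsLevelWord, List.nil_append, List.head?_cons, List.isChain_cons_cons,
        List.getLast?_cons_cons, Option.mem_def, Option.some.injEq, forall_eq', Step,
        List.getLast?_nil, reduceCtorEq, false_implies, implies_true, and_true, forall_const]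
      constructor
      · rintro ⟨a, ⟨b, b'⟩, e⟩; exact ⟨⟨by omega, b', e⟩, a⟩
      · rintro ⟨⟨a, b, e⟩, g⟩; exact ⟨g, ⟨⟨by omega, by omega⟩, b⟩, e⟩
  · have h1 := hle x (by simp)
    have h2 := hlt x (by simp)
    rcases l₂ with _ | ⟨y, l₂⟩
    · have h3 : 0 < d c ∨ d c = 0 ∧ d x = 0 := hpos.imp_right fun h => ⟨h.1, h.2 x (by simp)⟩
      have e : l.concat x ++ [c] = l ++ x :: c :: [] := by simp
      have e' : l.concat x ++ [] = l ++ [x] := by simp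
      rw [e, e']
      simp only [IsLevelWord, List.isChain_append_cons_cons, List.concat_eq_append,
        List.head?_append, List.head?_cons, List.getLast?_append, List.getLast?_cons_cons,
        Step, Precedes, List.getLast?_singleton, Option.mem_def, Option.some_or,
        Option.some.injEq, forall_eq', List.IsChain.singleton, List.append_eq_nil_iff,
        reduceCtorEq, and_false, false_implies, true_and, and_true]
      constructor
      · rintro ⟨a, ⟨b, b'⟩, e⟩; exact ⟨⟨a, b, by omega⟩, by omega⟩
      · rintro ⟨⟨a, b, e⟩, g⟩; exact ⟨a, ⟨b, by omega⟩, by omega⟩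
    · have h4 := hle y (by simp)
      have h5 := hlt y (by simp)
      simp only [IsLevelWord, List.concat_eq_append, List.append_assoc, List.cons_append,
        List.nil_append, List.isChain_append_cons_cons,
        List.head?_append, List.head?_cons, List.getLast?_append, List.getLast?_cons_cons,
        Step, Precedes, List.getLast?_singleton, Option.mem_def, Option.some_or,
        Option.some.injEq, forall_eq', List.isChain_cons_cons, List.append_eq_nil_iff,
        reduceCtorEq, and_false, false_implies, true_and]
      constructor
      · rintro ⟨a, ⟨b, ⟨b1, b2⟩, b3, b4⟩, e⟩
        exact ⟨⟨a, ⟨b, by omega, b4⟩, e⟩, by omega⟩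
      · rintro ⟨⟨a, ⟨b, b3, b4⟩, e⟩, g⟩
        exact ⟨a, ⟨b, by omega, by omega, b4⟩, e⟩

end Words

/-! ### Generating functions of words by insertion. -/

section Sums

variable {α : Type*} {K : Type*} [CommSemiring K] (q : K)

/-- The last entry of a word, if there is one, has a given property. -/
def LastSatisfies (P : α → Prop) (w : List α) : Prop := ∀ x ∈ w.getLast?, P x

-- The exponents at the admissible positions, read from right to left, are 0, 1, 2, …, since each
-- one counts the admissible entries still to come. The proposition `s` tells whether the front is
-- admissible too.
open Classical in
theorem sum_insert_positions (P : α → Prop) (s : Prop) [Decidable s] (w : List α) :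
    ∑ i ∈ range (w.length + 1) with (i = 0 → s) ∧ LastSatisfies P (w.take i),
        q ^ (w.drop i).countP (fun x => P x) =
      qInt q (w.countP (fun x => P x) + if s then 1 else 0) := by
  -- These are the positions after some entry; the front position is split off separately.
  have key : ∀ w : List α, ∑ i ∈ range w.length with LastSatisfies P (w.take (i + 1)),
      q ^ (w.drop (i + 1)).countP (fun x => P x) = qInt q (w.countP (fun x => P x)) := by
    intro w
    induction w with
    | nil => simp [qInt]
    | cons y w ih =>
      rw [sum_filter] at ih ⊢
      rw [List.length_cons, sum_range_succ']
      have : ∀ i ∈ range w.length, (if LastSatisfies P ((y :: w).take (i + 1 + 1)) then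
            q ^ ((y :: w).drop (i + 1 + 1)).countP (fun x => P x) else 0) =
          if LastSatisfies P (w.take (i + 1)) then
            q ^ (w.drop (i + 1)).countP (fun x => P x) else 0 := by
        intro i hi
        rcases w with _ | ⟨z, w⟩
        · simp at hi
        · simp [LastSatisfies, List.take_succ_cons, List.getLast?_cons_cons]
      rw [sum_congr rfl this, ih, List.countP_cons]
      by_cases hy : P y <;> simp [LastSatisfies, hy, qInt, sum_range_succ]
  rw [sum_filter, sum_range_succ']
  have h := key w
  rw [sum_filter] at h
  have h' : ∀ i ∈ range w.length, (if (i + 1 = 0 → s) ∧ LastSatisfies P (w.take (i + 1)) then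
      q ^ (w.drop (i + 1)).countP (fun x => P x) else 0) =
        if LastSatisfies P (w.take (i + 1)) then
          q ^ (w.drop (i + 1)).countP (fun x => P x) else 0 := fun i _ => by simp
  rw [sum_congr rfl h', h]
  by_cases hs : s <;> simp [LastSatisfies, hs, qInt, sum_range_succ]

open Classical in
/-- The words which list the elements of a finite set. -/
noncomputable def orderings (C : Finset α) : Finset (List α) := C.val.lists.toFinset

theorem mem_orderings {C : Finset α} {w : List α} : w ∈ orderings C ↔ C.val = w := by
  simp [orderings, Multiset.mem_lists_iff]

open Classical in
/-- The sum of `q ^ (primary + secondary inversions)` over all labelled paths with cars `C`, labels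
`v` and levels `d`. -/
noncomputable def levelSum (v d : α → ℤ) (C : Finset α) : K :=
  ∑ w ∈ orderings C with IsLevelWord v d w, q ^ pairCount (Inverted v d) w

theorem levelSum_neg (v d : α → ℤ) (C : Finset α) :
    levelSum q (-v) (-d) C = levelSum q v d C := by
  classical
  symm
  refine sum_nbij' List.reverse List.reverse ?_ ?_ (by simp) (by simp) ?_
  · intro w
    simp +contextual [isLevelWord_reverse_neg, mem_orderings]
  · intro w hw
    rw [← w.reverse_reverse] at hw
    simp only [mem_filter, mem_orderings, isLevelWord_reverse_neg] at hw ⊢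
    simpa using hw
  · intro w _
    rw [pairCount_reverse]
    congr 2
    funext x y
    simp [inverted_neg]

-- The entries after which `c` may stand are exactly those with which `c` forms an inversion when
-- they come after it, and nothing before `c` is inverted with it. So insertion into a fixed word
-- contributes a full `q`-integer.
open Classical in
theorem levelSum_erase {v d : α → ℤ} {C : Finset α} {c : α} (hc : c ∈ C)
    (h : IsTopMin v d c (C.erase c)) :
    levelSum q v d C = qInt q (#{x ∈ C.erase c | Precedes v d c x} + if d c ≤ 0 then 1 else 0) *
      levelSum q v d (C.erase c) := by
  have hmem : ∀ w : List α, w ∈ orderings (C.erase c) → ∀ x, x ∈ w ↔ x ∈ C.erase c := by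
    intro w hw x
    rw [mem_orderings] at hw
    rw [← Finset.mem_val, hw]; simp
  have hsplit : ∀ (w : List α) (i : ℕ), w.take i ++ w.drop i = w := fun w i =>
    List.take_append_drop i w
  have htop : ∀ w : List α, w ∈ orderings (C.erase c) → IsTopMin v d c {x | x ∈ w} := by
    intro w hw
    have : {x | x ∈ w} = ((C.erase c : Finset α) : Set α) := by
      ext x; simpa [and_comm] using hmem w hw x
    rwa [this]
  have hcount : ∀ w : List α, w ∈ orderings (C.erase c) →
      w.countP (fun x => Precedes v d c x) = #{x ∈ C.erase c | Precedes v d c x} := by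
    intro w hw
    rw [mem_orderings] at hw
    rw [Finset.card_def, Finset.filter_val, ← Multiset.countP_eq_card_filter, hw]
    simp
  rw [levelSum, levelSum, mul_sum]
  have hterm : ∀ w ∈ (orderings (C.erase c)).filter (IsLevelWord v d),
      qInt q (#{x ∈ C.erase c | Precedes v d c x} + if d c ≤ 0 then 1 else 0) *
        q ^ pairCount (Inverted v d) w =
      ∑ i ∈ range (w.length + 1) with
        (i = 0 → d c ≤ 0) ∧ LastSatisfies (Precedes v d c) (w.take i),
        q ^ pairCount (Inverted v d) (w.take i ++ c :: w.drop i) := by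
    intro w hw
    rw [mem_filter] at hw
    rw [← hcount w hw.1, ← sum_insert_positions, sum_mul]
    refine sum_congr rfl fun i _ => ?_
    rw [pairCount_insert, hsplit, ← pow_add]
    have h0 : (w.take i).countP (fun x => Inverted v d x c) = 0 := by
      rw [List.countP_eq_zero]
      intro x hx
      have hx' := List.mem_of_mem_take hx
      have h1 := (htop w hw.1).le x hx'
      have h2 := (htop w hw.1).lt x hx'
      rw [decide_eq_true_eq, Inverted]
      omega
    have h1 : (w.drop i).countP (fun x => Inverted v d c x) =
        (w.drop i).countP (fun x => Precedes v d c x) := by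
      refine List.countP_congr fun x hx => ?_
      have hx' := List.mem_of_mem_drop hx
      have h2 := (htop w hw.1).lt x hx'
      rw [decide_eq_true_eq, decide_eq_true_eq, Inverted, Precedes]
      omega
    rw [h0, h1]
    congr 1
    omega
  rw [sum_congr rfl hterm, sum_sigma']
  symm
  refine sum_nbij (fun p => p.1.take p.2 ++ c :: p.1.drop p.2) ?_ ?_ ?_ (fun _ _ => rfl)
  · rintro ⟨w, i⟩ hp
    simp only [mem_sigma, mem_filter, mem_range] at hp
    obtain ⟨⟨hw, hv⟩, hi, hi0, hP⟩ := hp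
    simp only [mem_filter]
    constructor
    · rw [mem_orderings] at hw ⊢
      rw [← Finset.insert_erase hc, Finset.insert_val_of_notMem (Finset.notMem_erase c C), hw]
      conv_lhs => rw [← hsplit w i]
      rw [Multiset.cons_coe, Multiset.coe_eq_coe]
      exact List.perm_middle.symm
    · rw [isLevelWord_insert (by rw [hsplit]; exact htop w hw), hsplit]
      refine ⟨hv, fun h => hi0 ?_, hP⟩
      have := congrArg List.length h
      simp at this
      rcases this with h | h
      · exact h
      · rw [h] at hi; simp at hi; exact hi
  -- Erasing `c` recovers the word, and the index of `c` recovers the position.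
  · rintro ⟨w, i⟩ hp ⟨w', i'⟩ hp' heq
    simp only [coe_sigma, Set.mem_sigma_iff, mem_coe, mem_filter, mem_range] at hp hp'
    have hcw : c ∉ w := fun h => by simpa using (hmem w hp.1.1 c).1 h
    have hcw' : c ∉ w' := fun h => by simpa using (hmem w' hp'.1.1 c).1 h
    have e1 : (w.take i ++ c :: w.drop i).erase c = w := by
      rw [List.erase_append_right _ fun h => hcw (List.mem_of_mem_take h), List.erase_cons_head,
        hsplit]
    have e1' : (w'.take i' ++ c :: w'.drop i').erase c = w' := by
      rw [List.erase_append_right _ fun h => hcw' (List.mem_of_mem_take h), List.erase_cons_head,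
        hsplit]
    have e2 : (w.take i ++ c :: w.drop i).idxOf c = i := by
      rw [List.idxOf_append_of_notMem fun h => hcw (List.mem_of_mem_take h)]
      simp; omega
    have e2' : (w'.take i' ++ c :: w'.drop i').idxOf c = i' := by
      rw [List.idxOf_append_of_notMem fun h => hcw' (List.mem_of_mem_take h)]
      simp; omega
    simp only at heq
    have hw : w = w' := by rw [← e1, heq, e1']
    have hi : i = i' := by rw [← e2, heq, e2']
    subst hw hi
    rfl
  · intro u hu
    simp only [coe_filter, Set.mem_ofPred_eq] at hu
    obtain ⟨hu, huv⟩ := hu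
    rw [mem_orderings] at hu
    have hcu : c ∈ u := by rw [← Finset.mem_val, hu] at hc; simpa using hc
    obtain ⟨l₁, l₂, rfl⟩ := List.append_of_mem hcu
    have hw : l₁ ++ l₂ ∈ orderings (C.erase c) := by
      rw [mem_orderings, Finset.erase_val, hu]
      rw [Multiset.coe_eq_coe.2 (List.perm_middle (a := c) (l₁ := l₁) (l₂ := l₂)),
        ← Multiset.cons_coe, Multiset.erase_cons_head]
    have hv := (isLevelWord_insert (htop _ hw)).1 huv
    refine ⟨⟨l₁ ++ l₂, l₁.length⟩, ?_, by simp⟩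
    simp only [coe_sigma, Set.mem_sigma_iff, mem_coe, mem_filter, mem_range]
    refine ⟨⟨hw, hv.1⟩, by simp, fun h => hv.2.1 (by simpa using h), ?_⟩
    simpa [LastSatisfies] using hv.2.2

end Sums

/-! ### The product formula for a given level function. -/

section Product

variable {α : Type*} (v d : α → ℤ) (C : Finset α)

/-- The number of places where a car on a positive level can be inserted, once the cars below its
level and the larger cars on its level are placed. -/
def upCount (c : α) : ℕ := #{x ∈ C | d x = d c ∧ v c < v x} + #{x ∈ C | d x = d c - 1 ∧ v x < v c}

/-- The number of places where a car on a negative level can be inserted, once the cars above its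
level and the smaller cars on its level are placed. -/
def downCount (c : α) : ℕ :=
  #{x ∈ C | d x = d c ∧ v x < v c} + #{x ∈ C | d x = d c + 1 ∧ v c < v x}

theorem upCount_neg (c : α) : upCount (-v) (-d) C c = downCount v d C c := by
  simp only [upCount, downCount, Pi.neg_apply, neg_inj, neg_lt_neg_iff]
  congr 4
  ext x; omega

theorem downCount_neg (c : α) : downCount (-v) (-d) C c = upCount v d C c := by
  rw [← upCount_neg, neg_neg, neg_neg]

variable {K : Type*} [CommSemiring K] (q : K)

/-- The `q`-factorial `[m]_q! = [1]_q [2]_q ⋯ [m]_q`. -/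
def qFact (m : ℕ) : K := ∏ i ∈ range m, qInt q (i + 1)

/-- The value of `levelSum` as a product of `q`-integers. -/
def levelProd : K :=
  qFact q #{c ∈ C | d c = 0} * ((∏ c ∈ C with 0 < d c, qInt q (upCount v d C c)) *
    ∏ c ∈ C with d c < 0, qInt q (downCount v d C c))

theorem levelProd_neg : levelProd (-v) (-d) C q = levelProd v d C q := by
  simp only [levelProd, upCount_neg, downCount_neg, Pi.neg_apply, neg_eq_zero, Left.neg_pos_iff,
    Left.neg_neg_iff]
  rw [mul_comm (∏ c ∈ C with d c < 0, _)]

variable {v d C}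

-- On a positive level, `c` is counted by no other factor: its own level counts only larger labels,
-- and negative levels look no higher than level 0. If all levels are 0, one factor of the
-- `q`-factorial splits off.
open Classical in
theorem levelProd_erase {c : α} (hc : c ∈ C) (h : IsTopMin v d c (C.erase c)) :
    levelProd v d C q = qInt q (#{x ∈ C.erase c | Precedes v d c x} + if d c ≤ 0 then 1 else 0) *
      levelProd v d (C.erase c) q := by
  have hle : ∀ x ∈ C, x ≠ c → d x ≤ d c ∧ (d x = d c → v c < v x) := fun x hx hxc =>
    ⟨h.le x (by simp [hx, hxc]), h.lt x (by simp [hx, hxc])⟩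
  rcases h.pos with hpos | ⟨h0, hall⟩
  · have e0 : C.filter (fun x => d x = 0) = (C.erase c).filter (fun x => d x = 0) := by
      ext x
      simp only [mem_filter, mem_erase]
      constructor
      · rintro ⟨hx, h0⟩
        exact ⟨⟨by rintro rfl; omega, hx⟩, h0⟩
      · rintro ⟨⟨_, hx⟩, h0⟩
        exact ⟨hx, h0⟩
    have e1 : C.filter (fun x => 0 < d x) = insert c ((C.erase c).filter (fun x => 0 < d x)) := by
      ext x
      by_cases hxc : x = c <;> simp [hxc, hc, hpos]
    have e2 : C.filter (fun x => d x < 0) = (C.erase c).filter (fun x => d x < 0) := by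
      ext x
      by_cases hxc : x = c
      · subst hxc
        simp only [mem_filter, mem_erase]
        omega
      · simp [hxc]
    have e3 : #{x ∈ C.erase c | Precedes v d c x} = upCount v d C c := by
      rw [upCount, ← card_union_of_disjoint]
      · congr 1
        ext x
        rw [mem_filter, mem_erase, mem_union, mem_filter, mem_filter, Precedes]
        constructor
        · rintro ⟨⟨hxc, hx⟩, h | h⟩
          · exact Or.inl ⟨hx, h, (hle x hx hxc).2 h⟩
          · exact Or.inr ⟨hx, h⟩
        · rintro (⟨hx, h, h'⟩ | ⟨hx, h, h'⟩)
          · exact ⟨⟨by rintro rfl; omega, hx⟩, Or.inl h⟩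
          · exact ⟨⟨by rintro rfl; omega, hx⟩, Or.inr ⟨h, h'⟩⟩
      · rw [disjoint_left]
        intro x
        simp only [mem_filter]
        omega
    have e4 : ∀ x ∈ (C.erase c).filter (fun x => 0 < d x),
        qInt q (upCount v d C x) = qInt q (upCount v d (C.erase c) x) := by
      intro x hx
      simp only [mem_filter, mem_erase] at hx
      have := hle x hx.1.2 hx.1.1
      rw [upCount, upCount, filter_erase, filter_erase, erase_eq_of_notMem, erase_eq_of_notMem]
      all_goals simp only [mem_filter]; omega
    have e5 : ∀ x ∈ (C.erase c).filter (fun x => d x < 0),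
        qInt q (downCount v d C x) = qInt q (downCount v d (C.erase c) x) := by
      intro x hx
      simp only [mem_filter, mem_erase] at hx
      have := hle x hx.1.2 hx.1.1
      rw [downCount, downCount, filter_erase, filter_erase, erase_eq_of_notMem,
        erase_eq_of_notMem]
      all_goals simp only [mem_filter]; omega
    rw [levelProd, levelProd, e0, e1, e2, prod_insert (by simp), e3, prod_congr rfl e4,
      prod_congr rfl e5, if_neg (by omega), add_zero]
    ring
  · have hall' : ∀ x ∈ C, d x = 0 := fun x hx => by
      by_cases hxc : x = c
      · rw [hxc, h0]
      · exact hall x (by simp [hx, hxc])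
    have f0 : ∀ D ⊆ C, levelProd v d D q = qFact q #D := by
      intro D hD
      rw [levelProd, filter_true_of_mem fun x hx => hall' x (hD hx),
        filter_false_of_mem fun x hx => by simp [hall' x (hD hx)],
        filter_false_of_mem fun x hx => by simp [hall' x (hD hx)]]
      simp
    rw [f0 C subset_rfl, f0 _ (erase_subset c C), filter_true_of_mem, if_pos h0.le,
      ← card_erase_add_one hc, qFact, prod_range_succ, mul_comm, qFact]
    intro x hx
    exact Or.inl (by rw [hall' x (mem_of_mem_erase hx), h0])

theorem exists_isTopMin (hv : Set.InjOn v C) (h : (∃ x ∈ C, 0 < d x) ∨ (∀ x ∈ C, d x = 0))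
    (hC : C.Nonempty) : ∃ c ∈ C, ∀ s ⊆ (C : Set α) \ {c}, IsTopMin v d c s := by
  obtain ⟨a, ha, hmax⟩ := exists_max_image C d hC
  obtain ⟨c, hc, hmin⟩ := exists_min_image {x ∈ C | d x = d a} v ⟨a, by simp [ha]⟩
  simp only [mem_filter] at hc hmin
  refine ⟨c, hc.1, fun s hs => ⟨fun x hx => ?_, fun x hx hxc => ?_, ?_⟩⟩
  · rw [hc.2]
    exact hmax x (by simpa using (hs hx).1)
  · have h1 : x ∈ C := by simpa using (hs hx).1
    exact lt_of_le_of_ne (hmin x ⟨h1, hxc.trans hc.2⟩)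
      fun h => (hs hx).2 (hv h1 hc.1 h.symm)
  · rcases h with ⟨x, hx, h⟩ | h
    · exact Or.inl (by have := hmax x hx; omega)
    · exact Or.inr ⟨h c hc.1, fun x hx => h x (by simpa using (hs hx).1)⟩

theorem levelSum_eq_levelProd (hv : Set.InjOn v C) : levelSum q v d C = levelProd v d C q := by
  classical
  induction hn : #C generalizing v d C with
  | zero =>
    rw [card_eq_zero] at hn
    subst hn
    have h : orderings (∅ : Finset α) = {[]} := by
      ext w
      rw [mem_orderings, mem_singleton, empty_val, eq_comm, Multiset.coe_eq_zero]
    rw [levelSum, h, filter_true_of_mem (by simp [IsLevelWord])]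
    simp [levelProd, qFact, pairCount]
  | succ n ih =>
    -- Stated for all labels and levels so that it also applies to the rotated path when no level is
    -- positive but some are negative.
    have step : ∀ v d : α → ℤ, Set.InjOn v C → ((∃ x ∈ C, 0 < d x) ∨ (∀ x ∈ C, d x = 0)) →
        levelSum q v d C = levelProd v d C q := by
      intro v d hv h
      obtain ⟨c, hc, htop⟩ := exists_isTopMin hv h (card_pos.1 (by omega))
      have htop := htop (C.erase c) (by simp)
      rw [levelSum_erase q hc htop, levelProd_erase q hc htop,
        ih (hv.mono (by simp)) (by rw [card_erase_of_mem hc]; omega)]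
    by_cases h : (∃ x ∈ C, 0 < d x) ∨ (∀ x ∈ C, d x = 0)
    · exact step v d hv h
    · rw [← levelSum_neg, ← levelProd_neg]
      refine step _ _ (fun x hx y hy hxy => hv hx hy (by simpa using hxy)) (Or.inl ?_)
      push Not at h
      obtain ⟨h1, x, hx, h2⟩ := h
      have := h1 x hx
      exact ⟨x, hx, by simp only [Pi.neg_apply]; omega⟩

end Product

/-! ### Moving the main diagonal by one level. -/

section Walk

variable {α : Type*} {K : Type*} [Field K] {q : K}

theorem qFact_succ {K : Type*} [CommSemiring K] (q : K) (m : ℕ) :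
    qFact q (m + 1) = qFact q m * qInt q (m + 1) := prod_range_succ _ _

/-- Induction by removing the largest label. If it lies in `A`, the other factors do not change. If
it lies in `B`, each of them drops by one, which is compensated by passing from `s` to `s + 1`; the
shift `s` is there for this case, and only `s = 0` is applied. -/
theorem qFact_mul_prod_shift (hq : ∀ m, 0 < m → qInt q m ≠ 0) (v : α → ℤ)
    (A B : Finset α) (hv : Set.InjOn v (A ∪ B : Set α)) (hAB : Disjoint A B) (s : ℕ) :
    qFact q (#A + s) * qInt q (#B + s) *
        ∏ b ∈ B, qInt q (#{x ∈ B | v b < v x} + #{x ∈ A | v x < v b} + s) =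
      qFact q (#B + s) * qInt q (#A + s) *
        ∏ a ∈ A, qInt q (#{x ∈ A | v x < v a} + #{x ∈ B | v a < v x} + s) := by
  classical
  induction hn : #(A ∪ B) generalizing A B s with
  | zero =>
    rw [card_eq_zero, union_eq_empty] at hn
    obtain ⟨rfl, rfl⟩ := hn
    simp
  | succ n ih =>
    obtain ⟨c, hc, hmax⟩ := exists_max_image (A ∪ B) v (card_pos.1 (by omega))
    have hlt : ∀ x ∈ A ∪ B, x ≠ c → v x < v c := fun x hx hxc =>
      lt_of_le_of_ne (hmax x hx) fun h => hxc (hv (by simpa using hx) (by simpa using hc) h)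
    rcases mem_union.1 hc with hcA | hcB
    · have hcB : c ∉ B := fun h => disjoint_left.1 hAB hcA h
      have IH := ih (A.erase c) B (hv.mono (by
          intro x; simp only [coe_erase, Set.mem_union, Set.mem_sdiff]; tauto))
        (hAB.mono_left (erase_subset c A)) s (by
          rw [← erase_eq_of_notMem hcB, ← erase_union_distrib, card_erase_of_mem hc]; omega)
      have e1 : ∏ b ∈ B, qInt q (#{x ∈ B | v b < v x} + #{x ∈ A.erase c | v x < v b} + s) =
          ∏ b ∈ B, qInt q (#{x ∈ B | v b < v x} + #{x ∈ A | v x < v b} + s) := by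
        refine prod_congr rfl fun b hb => ?_
        rw [filter_erase, erase_eq_of_notMem]
        have := hmax b (mem_union_right _ hb)
        simp only [mem_filter]; omega
      have e2 : ∏ a ∈ A.erase c, qInt q (#{x ∈ A.erase c | v x < v a} +
          #{x ∈ B | v a < v x} + s) =
          ∏ a ∈ A.erase c, qInt q (#{x ∈ A | v x < v a} + #{x ∈ B | v a < v x} + s) := by
        refine prod_congr rfl fun a ha => ?_
        rw [filter_erase, erase_eq_of_notMem]
        have := hmax a (mem_union_left _ (mem_of_mem_erase ha))
        simp only [mem_filter]; omega
      rw [e1, e2] at IH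
      have e3 : #{x ∈ A | v x < v c} = #(A.erase c) := by
        congr 1
        ext x
        simp only [mem_filter, mem_erase]
        constructor
        · rintro ⟨hx, h⟩; exact ⟨by rintro rfl; omega, hx⟩
        · rintro ⟨h, hx⟩; exact ⟨hx, hlt x (mem_union_left _ hx) h⟩
      have e4 : #{x ∈ B | v c < v x} = 0 := by
        rw [card_eq_zero, filter_eq_empty_iff]
        intro x hx
        have := hmax x (mem_union_right _ hx)
        omega
      rw [← mul_prod_erase A _ hcA, e3, e4, ← card_erase_add_one hcA,
        show #(A.erase c) + 1 + s = #(A.erase c) + s + 1 by ring, qFact_succ, add_zero]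
      linear_combination (qInt q (#(A.erase c) + s + 1)) * IH
    · have hcA : c ∉ A := fun h => disjoint_left.1 hAB h hcB
      have IH := ih A (B.erase c) (hv.mono (by
          intro x; simp only [coe_erase, Set.mem_union, Set.mem_sdiff]; tauto))
        (hAB.mono_right (erase_subset c B)) (s + 1) (by
          rw [← erase_eq_of_notMem hcA, ← erase_union_distrib, card_erase_of_mem hc]; omega)
      have e0 : ∀ y ∈ A ∪ B, y ≠ c →
          #{x ∈ B.erase c | v y < v x} + 1 = #{x ∈ B | v y < v x} := by
        intro y hy hyc
        rw [filter_erase, card_erase_add_one]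
        simp [hcB, hlt y hy hyc]
      have e1 : ∏ b ∈ B.erase c, qInt q (#{x ∈ B.erase c | v b < v x} +
          #{x ∈ A | v x < v b} + (s + 1)) =
          ∏ b ∈ B.erase c, qInt q (#{x ∈ B | v b < v x} + #{x ∈ A | v x < v b} + s) := by
        refine prod_congr rfl fun b hb => ?_
        rw [← e0 b (mem_union_right _ (mem_of_mem_erase hb)) (ne_of_mem_erase hb)]
        congr 1; ring
      have e2 : ∏ a ∈ A, qInt q (#{x ∈ A | v x < v a} +
          #{x ∈ B.erase c | v a < v x} + (s + 1)) =
          ∏ a ∈ A, qInt q (#{x ∈ A | v x < v a} + #{x ∈ B | v a < v x} + s) := by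
        refine prod_congr rfl fun a ha => ?_
        rw [← e0 a (mem_union_left _ ha) (fun h => hcA (h ▸ ha))]
        congr 1; ring
      rw [e1, e2] at IH
      have e3 : #{x ∈ B | v c < v x} = 0 := by
        rw [card_eq_zero, filter_eq_empty_iff]
        intro x hx
        have := hmax x (mem_union_right _ hx)
        omega
      have e4 : #{x ∈ A | v x < v c} = #A := by
        rw [filter_true_of_mem]
        exact fun x hx => hlt x (mem_union_left _ hx) fun h => hcA (h ▸ hx)
      rw [← mul_prod_erase B _ hcB, e3, e4, zero_add]
      rw [show #(B.erase c) + (s + 1) = #B + s by rw [← card_erase_add_one hcB]; ring,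
        show #A + (s + 1) = #A + s + 1 by ring, qFact_succ] at IH
      refine mul_left_cancel₀ (hq (#A + s + 1) (by omega)) ?_
      linear_combination (qInt q (#A + s)) * IH

/-- Moving the main diagonal up by one level multiplies `levelSum` by the quotient of the
`q`-integers of the numbers of cars on the new and on the old main diagonal. -/
theorem levelSum_shift (hq : ∀ m, 0 < m → qInt q m ≠ 0) (v d : α → ℤ) (C : Finset α)
    (hv : Set.InjOn v C) :
    levelSum q v (fun c => d c - 1) C * qInt q #{c ∈ C | d c = 0} =
      levelSum q v d C * qInt q #{c ∈ C | d c = 1} := by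
  classical
  have key := qFact_mul_prod_shift hq v {c ∈ C | d c = 0} {c ∈ C | d c = 1}
    (hv.mono (by intro x; simp only [coe_filter, Set.mem_union, Set.mem_ofPred_eq]; tauto))
    (by rw [disjoint_left]; intro x; simp only [mem_filter]; omega) 0
  have hup : ∀ c, upCount v (fun c => d c - 1) C c = upCount v d C c := by
    intro c; simp [upCount, sub_eq_iff_eq_add]
  have hdown : ∀ c, downCount v (fun c => d c - 1) C c = downCount v d C c := by
    intro c
    simp only [downCount]
    congr 4 <;> ext x <;> omega
  -- Level 1 turns from a product of up-counts into the `q`-factorial, and level 0 from the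
  -- `q`-factorial into a product of down-counts. All other factors agree on both sides.
  have s1 : C.filter (fun c => 0 < d c) =
      C.filter (fun c => d c = 1) ∪ C.filter (fun c => 0 < d c - 1) := by
    ext x; simp only [mem_filter, mem_union]
    rw [← and_or_left]; exact and_congr_right fun _ => by omega
  have s2 : C.filter (fun c => d c - 1 < 0) =
      C.filter (fun c => d c = 0) ∪ C.filter (fun c => d c < 0) := by
    ext x; simp only [mem_filter, mem_union]
    rw [← and_or_left]; exact and_congr_right fun _ => by omega
  have hB : ∏ c ∈ C with d c = 1, qInt q (upCount v d C c) =
      ∏ b ∈ C with d b = 1, qInt q (#{x ∈ C.filter (fun c => d c = 1) | v b < v x} +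
        #{x ∈ C.filter (fun c => d c = 0) | v x < v b} + 0) := by
    refine prod_congr rfl fun c hc => ?_
    simp only [mem_filter] at hc
    simp only [upCount, filter_filter, hc.2, add_zero, sub_self]
  have hA : ∏ c ∈ C with d c = 0, qInt q (downCount v d C c) =
      ∏ b ∈ C with d b = 0, qInt q (#{x ∈ C.filter (fun c => d c = 0) | v x < v b} +
        #{x ∈ C.filter (fun c => d c = 1) | v b < v x} + 0) := by
    refine prod_congr rfl fun c hc => ?_
    simp only [mem_filter] at hc
    simp only [downCount, filter_filter, hc.2, add_zero, zero_add]
  rw [levelSum_eq_levelProd q hv, levelSum_eq_levelProd q hv, levelProd, levelProd, s1, s2,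
    prod_union, prod_union, prod_congr rfl fun c _ => congrArg (qInt q) (hup c),
    prod_congr rfl fun c _ => congrArg (qInt q) (hdown c),
    prod_congr rfl fun c _ => congrArg (qInt q) (hdown c), hA, hB]
  · simp only [sub_eq_zero, add_zero] at key ⊢
    linear_combination -(∏ c ∈ C with 0 < d c - 1, qInt q (upCount v d C c)) *
      (∏ c ∈ C with d c < 0, qInt q (downCount v d C c)) * key
  all_goals rw [disjoint_left]; intro x; simp only [mem_filter]; omega

end Walk

variable {n : ℕ}

/-! ### Preference functions as words in row order. -/

section Rows

/-- The label of a car, as an integer. -/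
def label (c : Fin n) : ℤ := (c : ℕ)

theorem row_lt_row_iff (f : PrefFun n) (x y : Fin n) :
    row f x < row f y ↔ f x < f y ∨ (f x = f y ∧ x < y) := by
  have key : ∀ x y : Fin n, (f x < f y ∨ (f x = f y ∧ x < y)) → row f x < row f y := by
    intro x y h
    refine card_lt_card ((ssubset_iff_of_subset ?_).2 ⟨x, ?_, ?_⟩)
    · intro z
      simp only [mem_filter, mem_univ, true_and]
      omega
    · simpa using h
    · simp
  constructor
  · intro h
    by_contra hxy
    have h1 : ¬(f y < f x ∨ (f y = f x ∧ y < x)) := fun h' => by have := key y x h'; omega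
    have : x = y := by omega
    subst this
    omega
  · exact key x y

theorem row_injective (f : PrefFun n) : Function.Injective (row f) := by
  intro x y h
  have h1 := row_lt_row_iff f x y
  have h2 := row_lt_row_iff f y x
  omega

theorem row_lt (f : PrefFun n) (c : Fin n) : row f c < n := by
  have : row f c < #(univ : Finset (Fin n)) :=
    card_lt_card ((ssubset_iff_of_subset (subset_univ _)).2 ⟨c, mem_univ _, by simp⟩)
  simpa using this

/-- The rows of the cars, as a permutation. -/
noncomputable def rowPerm (f : PrefFun n) : Equiv.Perm (Fin n) :=
  Equiv.ofBijective (fun c => ⟨row f c, row_lt f c⟩) <|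
    Finite.injective_iff_bijective.1 fun x y h => row_injective f (by simpa using h)

theorem rowPerm_apply (f : PrefFun n) (c : Fin n) : (rowPerm f c : ℕ) = row f c := rfl

theorem row_eq_of_strictMono (f : PrefFun n) (e : Equiv.Perm (Fin n))
    (h : ∀ i j, i < j → f (e i) < f (e j) ∨ (f (e i) = f (e j) ∧ e i < e j)) (i : Fin n) :
    row f (e i) = i := by
  have h2 : {c' : Fin n | f c' < f (e i) ∨ (f c' = f (e i) ∧ c' < e i)} =
      {c' : Fin n | e.symm c' < i} := by
    ext c
    obtain ⟨j, rfl⟩ := e.surjective c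
    simp only [Set.mem_ofPred_eq, Equiv.symm_apply_apply]
    rcases lt_trichotomy i j with hij | rfl | hij
    · have := h i j hij
      omega
    · simp
    · have := h j i hij
      omega
  have h3 : row f (e i) = #{c' : Fin n | e.symm c' < i} := by
    unfold row
    congr 1
    ext c
    have := Set.ext_iff.1 h2 c
    simpa using this
  rw [h3, ← Fin.card_Iio i]
  exact card_nbij' e.symm e (by intro; simp) (by intro; simp) (by intro; simp) (by intro; simp)

theorem diag_rowPerm_symm_zero_le {m : ℕ} (f : PrefFun (m + 1)) :
    diag f ((rowPerm f).symm 0) ≤ 0 := by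
  have : row f ((rowPerm f).symm 0) = 0 := by rw [← rowPerm_apply]; simp
  simp only [diag, this]; omega

theorem le_diag_rowPerm_symm_last {m : ℕ} (f : PrefFun (m + 1)) :
    0 ≤ diag f ((rowPerm f).symm (Fin.last m)) := by
  have : row f ((rowPerm f).symm (Fin.last m)) = m := by rw [← rowPerm_apply]; simp
  simp only [diag, this]; omega

theorem step_rowPerm_symm {m : ℕ} (f : PrefFun (m + 1)) (i : Fin m) :
    Step label (diag f) ((rowPerm f).symm i.castSucc)
      ((rowPerm f).symm i.succ) := by
  set x := (rowPerm f).symm i.castSucc with hx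
  set y := (rowPerm f).symm i.succ with hy
  have h1 : row f x = i := by rw [← rowPerm_apply, hx]; simp
  have h2 : row f y = i + 1 := by rw [← rowPerm_apply, hy]; simp
  have h3 := (row_lt_row_iff f x y).1 (by omega)
  simp only [Step, label, diag, h1, h2]
  omega

/-- The car in row `i` has to lie in column `i - d (e i)`. The step condition says that the pairs
(column, label) increase lexicographically, and the two end conditions keep the columns between `0`
and `m`. -/
theorem exists_prefFun_of_word {m : ℕ} (d : Fin (m + 1) → ℤ) (e : Equiv.Perm (Fin (m + 1)))
    (h0 : d (e 0) ≤ 0) (hlast : 0 ≤ d (e (Fin.last m)))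
    (hstep : ∀ i : Fin m, Step label d (e i.castSucc) (e i.succ)) :
    ∃ f : PrefFun (m + 1), (∀ c, diag f c = d c) ∧ (rowPerm f).symm = e := by
  have hmono : StrictMono fun i : Fin (m + 1) =>
      toLex (((i : ℕ) : ℤ) - d (e i), ((e i : ℕ) : ℤ)) := by
    rw [Fin.strictMono_iff_lt_succ]
    intro i
    have := hstep i
    simp only [Step, label, Prod.Lex.toLex_lt_toLex, Fin.val_succ, Fin.val_castSucc] at this ⊢
    push_cast
    omega
  have hmono' : ∀ i j : Fin (m + 1), i < j → ((i : ℕ) : ℤ) - d (e i) < ((j : ℕ) : ℤ) - d (e j) ∨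
      (((i : ℕ) : ℤ) - d (e i) = ((j : ℕ) : ℤ) - d (e j) ∧ e i < e j) := by
    intro i j hij
    have := hmono hij
    simp only [Prod.Lex.toLex_lt_toLex] at this
    omega
  have hle : ∀ i j : Fin (m + 1), i ≤ j →
      ((i : ℕ) : ℤ) - d (e i) ≤ ((j : ℕ) : ℤ) - d (e j) := by
    intro i j hij
    rcases hij.lt_or_eq with h | rfl
    · have := hmono' i j h; omega
    · rfl
  have hbound : ∀ i : Fin (m + 1), 0 ≤ ((i : ℕ) : ℤ) - d (e i) ∧
      ((i : ℕ) : ℤ) - d (e i) < (m + 1 : ℕ) := by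
    intro i
    have h1 := hle 0 i (Fin.zero_le i)
    have h2 := hle i (Fin.last m) (Fin.le_last i)
    simp only [Fin.val_zero, Fin.val_last] at h1 h2
    push_cast at *
    omega
  have hbound' : ∀ c, 0 ≤ ((e.symm c : ℕ) : ℤ) - d c ∧
      ((e.symm c : ℕ) : ℤ) - d c < (m + 1 : ℕ) := fun c => by simpa using hbound (e.symm c)
  let f : PrefFun (m + 1) := fun c => ⟨(((e.symm c : ℕ) : ℤ) - d c).toNat, by
    have := hbound' c; omega⟩
  have hf : ∀ c, ((f c : ℕ) : ℤ) = ((e.symm c : ℕ) : ℤ) - d c := fun c => by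
    have := hbound' c
    simp only [f]; omega
  have hrow : ∀ i, row f (e i) = i := by
    refine row_eq_of_strictMono f e fun i j hij => ?_
    have h1 := hf (e i)
    have h2 := hf (e j)
    rw [Equiv.symm_apply_apply] at h1 h2
    have := hmono' i j hij
    omega
  refine ⟨f, fun c => ?_, ?_⟩
  · have := hrow (e.symm c)
    rw [Equiv.apply_symm_apply] at this
    rw [diag, hf, this]
    ring
  · ext i
    rw [← (rowPerm f).symm_apply_apply (e i)]
    congr 2
    ext
    rw [rowPerm_apply, hrow]

end Rows

/-! ### Diagonal inversions as pairs of entries of a word. -/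

section PairCount

variable {α : Type*}

theorem mem_orderings_univ {w : List (Fin n)} :
    w ∈ orderings (univ : Finset (Fin n)) ↔ ∃ e : Equiv.Perm (Fin n), List.ofFn e = w := by
  rw [mem_orderings]
  constructor
  · intro h
    have hnd : w.Nodup := by rw [← Multiset.coe_nodup, ← h]; exact univ.nodup
    have hlen : w.length = n := by
      rw [← Multiset.coe_card, ← h]; exact card_fin n
    have hinj : Function.Injective fun i : Fin n => w.get (i.cast hlen.symm) := fun i j hij => by
      simpa using (List.nodup_iff_injective_get.1 hnd) hij
    refine ⟨Equiv.ofBijective _ (Finite.injective_iff_bijective.1 hinj), ?_⟩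
    refine List.ext_get (by simp [hlen]) fun i h1 h2 => ?_
    simp
  · rintro ⟨e, rfl⟩
    refine Multiset.Nodup.ext univ.nodup ?_ |>.2 fun c => ?_
    · exact Multiset.coe_nodup.2 (List.nodup_ofFn.2 e.injective)
    · simpa [List.mem_ofFn] using e.surjective c

open Classical in
theorem countP_ofFn (p : α → Prop) (m : ℕ) (g : Fin m → α) :
    (List.ofFn g).countP (fun x => p x) = ∑ i, if p (g i) then 1 else 0 := by
  induction m with
  | zero => simp
  | succ m ih =>
    rw [List.ofFn_succ, List.countP_cons, ih, Fin.sum_univ_succ, add_comm]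
    simp

open Classical in
theorem pairCount_ofFn (T : α → α → Prop) (m : ℕ) (g : Fin m → α) :
    pairCount T (List.ofFn g) = ∑ i, ∑ j, if i < j ∧ T (g i) (g j) then 1 else 0 := by
  induction m with
  | zero => simp [pairCount]
  | succ m ih =>
    rw [List.ofFn_succ, pairCount, ih, Fin.sum_univ_succ, Fin.sum_univ_succ, countP_ofFn]
    simp only [Fin.sum_univ_succ (n := m), Fin.succ_lt_succ_iff, Fin.succ_pos, Fin.not_lt_zero,
      lt_irrefl, true_and, false_and, if_false, zero_add]

theorem isLevelWord_ofFn (v d : α → ℤ) {m : ℕ} (g : Fin (m + 1) → α) :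
    IsLevelWord v d (List.ofFn g) ↔
      d (g 0) ≤ 0 ∧ (∀ i : Fin m, Step v d (g i.castSucc) (g i.succ)) ∧ 0 ≤ d (g (Fin.last m)) := by
  rw [IsLevelWord]
  refine and_congr ?_ (and_congr ?_ ?_)
  · simp [List.ofFn_succ]
  · rw [List.isChain_ofFn]
    exact ⟨fun h i => h i (by omega), fun h i hi => h ⟨i, by omega⟩⟩
  · rw [List.ofFn_succ_last]
    simp

end PairCount

theorem primaryDinv_add_secondaryDinv (f : PrefFun n) :
    primaryDinv f + secondaryDinv f =
      pairCount (Inverted label (diag f)) (List.ofFn (rowPerm f).symm) := by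
  classical
  rw [pairCount_ofFn, ← Fintype.sum_prod_type', ← card_filter]
  have h1 : ∀ p : Fin n × Fin n, rowPerm f p.1 < rowPerm f p.2 ↔
      f p.1 < f p.2 ∨ (f p.1 = f p.2 ∧ p.1 < p.2) := fun p => by
    rw [← row_lt_row_iff, Fin.lt_def, rowPerm_apply, rowPerm_apply]
  have h2 : ∀ p : Fin n × Fin n, row f p.1 < row f p.2 ↔
      f p.1 < f p.2 ∨ (f p.1 = f p.2 ∧ p.1 < p.2) := fun p => row_lt_row_iff f _ _
  have h3 : secondaryDinv f = #{p : Fin n × Fin n | p.2 < p.1 ∧ diag f p.1 = diag f p.2 + 1 ∧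
      f p.1 < f p.2} :=
    card_nbij' Prod.swap Prod.swap (by intro; simp) (by intro; simp) (by intro; simp)
      (by intro; simp)
  rw [primaryDinv, h3, ← card_union_of_disjoint]
  · refine card_nbij' (Prod.map (rowPerm f) (rowPerm f))
      (Prod.map (rowPerm f).symm (rowPerm f).symm) ?_ ?_ (by rintro ⟨x, y⟩ _; simp)
      (by rintro ⟨x, y⟩ _; simp)
    · rintro ⟨x, y⟩
      have a1 := h1 (x, y)
      simp only [mem_coe, mem_union, mem_filter, mem_univ, true_and, Prod.map_apply,
        Equiv.symm_apply_apply] at a1 ⊢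
      simp only [Inverted, label]
      omega
    · rintro ⟨i, j⟩
      obtain ⟨x, rfl⟩ := (rowPerm f).surjective i
      obtain ⟨y, rfl⟩ := (rowPerm f).surjective j
      have a1 := h1 (x, y)
      have a2 := h2 (x, y)
      simp only [mem_coe, mem_union, mem_filter, mem_univ, true_and, Prod.map_apply,
        Equiv.symm_apply_apply] at a1 a2 ⊢
      simp only [Inverted, label, diag] at a1 a2 ⊢
      omega
  · rw [disjoint_left]
    intro p
    simp only [mem_filter]
    omega

/-- The preference functions with given diagonals, as words. -/
theorem sum_prefFun_diag_eq {K : Type*} [CommSemiring K] (q : K) {m : ℕ} (d : Fin (m + 1) → ℤ) :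
    ∑ f : PrefFun (m + 1) with diag f = d, q ^ (primaryDinv f + secondaryDinv f) =
      levelSum q label d univ := by
  classical
  rw [levelSum]
  refine sum_nbij (fun f => List.ofFn (rowPerm f).symm) ?_ ?_ ?_ ?_
  · intro f hf
    rw [mem_filter] at hf ⊢
    obtain rfl := hf.2
    exact ⟨mem_orderings_univ.2 ⟨_, rfl⟩, (isLevelWord_ofFn _ _ _).2
      ⟨diag_rowPerm_symm_zero_le f, step_rowPerm_symm f, le_diag_rowPerm_symm_last f⟩⟩
  · intro f hf g hg h
    simp only [coe_filter, mem_univ, true_and, Set.mem_ofPred_eq] at hf hg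
    have h' : rowPerm f = rowPerm g := by
      have := List.ofFn_injective h
      rw [← (rowPerm f).symm_symm, ← (rowPerm g).symm_symm, DFunLike.coe_injective this]
    funext c
    have h1 : row f c = row g c := by rw [← rowPerm_apply, ← rowPerm_apply, h']
    have h2 : diag f c = diag g c := by rw [hf, hg]
    simp only [diag, h1] at h2
    omega
  · intro w hw
    simp only [coe_filter, Set.mem_ofPred_eq, mem_orderings_univ] at hw
    obtain ⟨⟨e, rfl⟩, hw⟩ := hw
    rw [isLevelWord_ofFn] at hw
    obtain ⟨f, hf, he⟩ := exists_prefFun_of_word d e hw.1 hw.2.2 hw.2.1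
    refine ⟨f, by simpa using funext hf, by simp only [he]⟩
  · intro f hf
    rw [mem_filter] at hf
    rw [primaryDinv_add_secondaryDinv, hf.2]

theorem isParking_iff (f : PrefFun n) : IsParking f ↔ ∀ c, 0 ≤ diag f c := by
  constructor
  · intro h c
    have h1 := h (f c) (f c).2.le
    have h2 : #{c' : Fin n | (f c' : ℕ) < f c} ≤ row f c := card_le_card fun x hx => by
      simp only [mem_filter, mem_univ, true_and] at hx ⊢
      exact Or.inl hx
    simp only [diag]; omega
  · intro h k hk
    by_contra! hlt
    set s := #{c : Fin n | (f c : ℕ) < k} with hs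
    -- With only `s < k` cars in the first `k` columns, the car in row `s` lies in a column at least
    -- `k`, hence in a negative diagonal.
    let c := (rowPerm f).symm ⟨s, by omega⟩
    have hc : row f c = s := by rw [← rowPerm_apply]; simp [c]
    have hck : k ≤ f c := by
      by_contra! hck
      have : row f c < s := card_lt_card ((ssubset_iff_of_subset fun x hx => by
        simp only [mem_filter, mem_univ, true_and] at hx ⊢
        omega).2 ⟨c, by simpa using hck, by simp⟩)
      omega
    have := h c
    simp only [diag] at this
    omega

/-! ### Diagonal words and the runs of τ. -/

section Levels

variable {m : ℕ} (τ : Equiv.Perm (Fin (m + 1)))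

/-- The number of descents of `τ` from the position of the car `c` on. The runs of `τ` are the sets
of cars of equal level. -/
def level (c : Fin (m + 1)) : ℕ :=
  #{i : Fin m | τ.symm c ≤ i.castSucc ∧ τ i.succ < τ i.castSucc}

theorem level_castSucc (i : Fin m) :
    level τ (τ i.castSucc) = level τ (τ i.succ) + if τ i.succ < τ i.castSucc then 1 else 0 := by
  have h1 : ∀ j : Fin m, j ∈ ({j : Fin m | i.castSucc ≤ j.castSucc ∧ τ j.succ < τ j.castSucc} :
      Finset (Fin m)) ↔ (j = i ∨ i.succ ≤ j.castSucc) ∧ τ j.succ < τ j.castSucc := by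
    intro j
    simp only [mem_filter, mem_univ, true_and, Fin.le_def, Fin.val_castSucc, Fin.val_succ,
      Fin.ext_iff]
    exact and_congr_left fun _ => by omega
  have h2 : i ∉ ({j : Fin m | i.succ ≤ j.castSucc ∧ τ j.succ < τ j.castSucc} : Finset (Fin m)) := by
    simp [Fin.le_def]
  simp only [level, Equiv.symm_apply_apply]
  split_ifs with h
  · rw [← card_insert_of_notMem h2]
    congr 1
    ext j
    rw [h1, mem_insert, mem_filter]
    by_cases hj : j = i
    · simp [hj, h]
    · simp [hj]
  · rw [add_zero]
    congr 1
    ext j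
    rw [h1, mem_filter]
    by_cases hj : j = i
    · simp [hj, h]
    · simp [hj]

theorem level_last : level τ (τ (Fin.last m)) = 0 := by
  rw [level, card_eq_zero, filter_eq_empty_iff]
  rintro i _ ⟨h, -⟩
  rw [Equiv.symm_apply_apply, Fin.le_def] at h
  simp only [Fin.val_last, Fin.val_castSucc] at h
  omega

theorem strictMono_level : StrictMono fun p => toLex (-(level τ (τ p) : ℤ), τ p) := by
  rw [Fin.strictMono_iff_lt_succ]
  intro i
  have h1 := level_castSucc τ i
  have h2 : τ i.castSucc ≠ τ i.succ := fun h => by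
    simpa [Fin.ext_iff] using τ.injective h
  rw [Prod.Lex.toLex_lt_toLex]
  split_ifs at h1 with h
  · exact Or.inl (by simp only; omega)
  · exact Or.inr ⟨by simp only; omega, by simp only; omega⟩

theorem level_le_of_le {p r : Fin (m + 1)} (h : p ≤ r) : level τ (τ r) ≤ level τ (τ p) := by
  have := (strictMono_level τ).monotone h
  simp only [Prod.Lex.toLex_le_toLex] at this
  omega

theorem level_le (c : Fin (m + 1)) : level τ c ≤ level τ (τ 0) := by
  simpa using level_le_of_le τ (Fin.zero_le (τ.symm c))

theorem exists_crossing (P : Fin (m + 1) → Prop) {a b : Fin (m + 1)} (hab : a ≤ b) (ha : ¬P a)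
    (hb : P b) : ∃ i : Fin m, ¬P i.castSucc ∧ P i.succ := by
  by_contra! h
  have : Antitone P := Fin.antitone_iff_succ_le.2 fun i hi => by
    by_contra h'
    exact h i h' hi
  exact ha (this hab hb)

theorem exists_level_eq {l : ℕ} (hl : l ≤ level τ (τ 0)) : ∃ c, level τ c = l := by
  rcases Nat.eq_zero_or_pos l with rfl | hpos
  · exact ⟨_, level_last τ⟩
  · obtain ⟨i, h1, h2⟩ := exists_crossing (fun p => level τ (τ p) < l) (Fin.zero_le (Fin.last m))
      (by simpa using hl) (by rw [level_last]; exact hpos)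
    refine ⟨τ i.castSucc, ?_⟩
    have := level_castSucc τ i
    split_ifs at this <;> omega

theorem card_level_eq_zero : #{c | level τ c = 0} = lastRunLength τ := by
  refine card_nbij' τ.symm τ ?_ ?_ (by intro; simp) (by intro; simp)
  · intro c hc
    obtain ⟨p, rfl⟩ := τ.surjective c
    simp only [coe_filter, mem_univ, true_and, Set.mem_ofPred_eq, Equiv.symm_apply_apply] at hc ⊢
    intro j k hj hk
    have h1 := level_le_of_le τ hj
    have h2 := level_le_of_le τ (hj.trans hk.le)
    have h3 := strictMono_level τ hk
    simp only [Prod.Lex.toLex_lt_toLex] at h3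
    omega
  · intro p hp
    simp only [coe_filter, mem_univ, true_and, Set.mem_ofPred_eq] at hp ⊢
    rw [level, card_eq_zero, filter_eq_empty_iff]
    rintro i _ ⟨h1, h2⟩
    rw [Equiv.symm_apply_apply] at h1
    have := hp i.castSucc i.succ h1 Fin.castSucc_lt_succ
    omega

/-- The path must enter the region of diagonals at least `diag f x` from below: on the way from its
start to `x` if that diagonal is positive, otherwise on the way from `y` to its end. -/
theorem exists_step_of_lt (f : PrefFun (m + 1)) {x y : Fin (m + 1)} (h : diag f y < diag f x) :
    ∃ a b, Step label (diag f) a b ∧ diag f a < diag f x ∧ diag f x ≤ diag f b := by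
  have key : ∃ i : Fin m, ¬diag f x ≤ diag f ((rowPerm f).symm i.castSucc) ∧
      diag f x ≤ diag f ((rowPerm f).symm i.succ) := by
    by_cases hx : 0 < diag f x
    · exact exists_crossing (fun p => diag f x ≤ diag f ((rowPerm f).symm p))
        (Fin.zero_le (rowPerm f x)) (by have := diag_rowPerm_symm_zero_le f; omega) (by simp)
    · exact exists_crossing (fun p => diag f x ≤ diag f ((rowPerm f).symm p))
        (Fin.le_last (rowPerm f y)) (by simpa using h)
        (by have := le_diag_rowPerm_symm_last f; omega)
  obtain ⟨i, h1, h2⟩ := key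
  exact ⟨_, _, step_rowPerm_symm f i, by omega, h2⟩

/-- The diagonal word is `τ` if and only if the diagonals are the runs of `τ`. -/
theorem diagWord_eq_iff (f : PrefFun (m + 1)) :
    diagWord f = τ ↔ ∃ l : ℕ, l ≤ level τ (τ 0) ∧ diag f = fun c => (level τ c : ℤ) - l := by
  constructor
  · intro h
    have hmono := (Tuple.eq_sort_iff.1 h.symm).1
    have hpos : ∀ p r, p ≤ r → diag f (τ r) < diag f (τ p) ∨
        diag f (τ r) = diag f (τ p) ∧ τ p ≤ τ r := by
      intro p r hpr
      have := hmono hpr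
      simp only [Function.comp, Prod.Lex.toLex_le_toLex] at this
      omega
    have hstep : ∀ i : Fin m, diag f (τ i.castSucc) =
        diag f (τ i.succ) + if τ i.succ < τ i.castSucc then 1 else 0 := by
      intro i
      rcases hpos _ _ i.castSucc_lt_succ.le with hi | ⟨hi, hlt⟩
      -- No car comes between these two in the diagonal word. The rising step therefore joins their
      -- diagonals, which are adjacent, and `τ i.succ ≤ a < b ≤ τ i.castSucc` shows that τ descends
      -- here.
      · obtain ⟨a, b, hab, ha, hb⟩ := exists_step_of_lt f hi
        have hall : ∀ c, (diag f (τ i.castSucc) < diag f c ∨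
            diag f (τ i.castSucc) = diag f c ∧ c ≤ τ i.castSucc) ∨
            (diag f c < diag f (τ i.succ) ∨ diag f c = diag f (τ i.succ) ∧ τ i.succ ≤ c) := by
          intro c
          obtain ⟨j, rfl⟩ := τ.surjective c
          rcases lt_or_ge j i.succ with hj | hj
          · exact Or.inl (hpos _ _ (Fin.le_castSucc_iff.2 hj))
          · exact Or.inr (hpos _ _ hj)
        have h1 := hall a
        have h2 := hall b
        simp only [Step, label] at hab
        rw [if_pos (by omega)]
        omega
      · rw [if_neg (by omega), hi, add_zero]
    have hconst : ∀ p, (level τ (τ p) : ℤ) - diag f (τ p) =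
        (level τ (τ 0) : ℤ) - diag f (τ 0) := by
      intro p
      induction p using Fin.induction with
      | zero => rfl
      | succ i ih =>
        have h1 := level_castSucc τ i
        have h2 := hstep i
        split_ifs at h1 h2 <;> omega
    have hall : ∀ c, diag f c = (level τ c : ℤ) - ((level τ (τ 0) : ℤ) - diag f (τ 0)) := by
      intro c
      have := hconst (τ.symm c)
      rw [Equiv.apply_symm_apply] at this
      omega
    -- The path starts in a diagonal at most 0 and ends in one at least 0, which bounds the shift
    -- from below and from above.
    have h0 := hall ((rowPerm f).symm 0)
    have h1 := diag_rowPerm_symm_zero_le f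
    have h2 := hall ((rowPerm f).symm (Fin.last m))
    have h3 := le_diag_rowPerm_symm_last f
    have h4 := level_le τ ((rowPerm f).symm (Fin.last m))
    refine ⟨((level τ (τ 0) : ℤ) - diag f (τ 0)).toNat, by omega, ?_⟩
    funext c
    rw [hall c]
    omega
  · rintro ⟨l, -, h⟩
    symm
    rw [diagWord, Tuple.eq_sort_iff]
    have hlt : ∀ i j, i < j → toLex (-diag f (τ i), τ i) < toLex (-diag f (τ j), τ j) := by
      intro i j hij
      have := strictMono_level τ hij
      simp only [Prod.Lex.toLex_lt_toLex, h] at this ⊢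
      omega
    exact ⟨(show StrictMono _ from hlt).monotone, fun i j hij he => absurd he (hlt i j hij).ne⟩

variable {τ}

theorem deviation_eq {f : PrefFun (m + 1)} {l : ℕ}
    (h : diag f = fun c => (level τ c : ℤ) - l) : deviation f = l := by
  refine le_antisymm (Finset.sup_le fun c _ => by rw [h]; simp only; omega) ?_
  refine le_trans ?_ (Finset.le_sup (mem_univ (τ (Fin.last m))))
  rw [h]
  simp [level_last]

theorem area_eq {f : PrefFun (m + 1)} {l : ℕ} (h : diag f = fun c => (level τ c : ℤ) - l) :
    area f = ∑ c, level τ c :=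
  sum_congr rfl fun c _ => by rw [deviation_eq h, h]; simp

theorem tertiaryDinv_eq {f : PrefFun (m + 1)} {l : ℕ}
    (h : diag f = fun c => (level τ c : ℤ) - l) : tertiaryDinv f = #{c | level τ c < l} := by
  simp [tertiaryDinv, h]

theorem isParking_iff_eq_zero {f : PrefFun (m + 1)} {l : ℕ}
    (h : diag f = fun c => (level τ c : ℤ) - l) : IsParking f ↔ l = 0 := by
  rw [isParking_iff, h]
  constructor
  · intro h0
    have := h0 (τ (Fin.last m))
    simpa [level_last] using this
  · rintro rfl c
    simp

theorem diag_eq_iff (f : PrefFun (m + 1)) (l : ℕ) (hl : l ≤ level τ (τ 0)) :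
    diag f = (fun c => (level τ c : ℤ) - l) ↔ diagWord f = τ ∧ deviation f = l := by
  rw [diagWord_eq_iff]
  constructor
  · exact fun h => ⟨⟨l, hl, h⟩, deviation_eq h⟩
  · rintro ⟨⟨l', _, h⟩, h'⟩
    rwa [← h', deviation_eq h]

end Levels

/-! ### The identity for the `q`-counts. -/

section Hilbert

variable {K : Type*} [Field K] {q : K} {m : ℕ} (τ : Equiv.Perm (Fin (m + 1)))

theorem qInt_add (q : K) (a b : ℕ) : qInt q (a + b) = qInt q a + q ^ a * qInt q b := by
  simp only [qInt, sum_range_add, mul_sum, pow_add]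

theorem levelSum_level (hq : ∀ m, 0 < m → qInt q m ≠ 0) {l : ℕ} (hl : l ≤ level τ (τ 0)) :
    levelSum q label (fun c => (level τ c : ℤ) - l) univ * qInt q #{c | level τ c = 0} =
      levelSum q label (fun c => (level τ c : ℤ)) univ * qInt q #{c | level τ c = l} := by
  induction l with
  | zero => simp
  | succ l ih =>
    have h1 := levelSum_shift hq label (fun c => (level τ c : ℤ) - l) univ
      (Set.injOn_of_injective fun x y h => by simpa [label, Fin.ext_iff] using h)
    simp only [sub_eq_zero, Nat.cast_inj] at h1
    have h2 : #{c | (level τ c : ℤ) - l = 1} = #{c | level τ c = l + 1} := by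
      congr 1; ext c; simp only [mem_filter, mem_univ, true_and]; omega
    rw [h2] at h1
    have h3 := ih (by omega)
    have h4 : (fun c => (level τ c : ℤ) - (l + 1 : ℕ)) = fun c => (level τ c : ℤ) - l - 1 := by
      funext c; push_cast; ring
    -- No level is empty, so its `q`-integer can be cancelled.
    obtain ⟨c, hc⟩ := exists_level_eq τ (l := l) (by omega)
    rw [h4]
    refine mul_right_cancel₀ (hq #{c | level τ c = l} (card_pos.2 ⟨c, by simpa using hc⟩)) ?_
    linear_combination qInt q #{c | level τ c = 0} * h1 + qInt q #{c | level τ c = l + 1} * h3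

/-- The exponents in `[m]_q` are cut into consecutive intervals, one per level; the power of `q` is
the contribution of the cars in negative diagonals at deviation `i`. -/
theorem sum_range_qInt_level (l : ℕ) :
    ∑ i ∈ range l, q ^ #{c | level τ c < i} * qInt q #{c | level τ c = i} =
      qInt q #{c | level τ c < l} := by
  induction l with
  | zero => simp [qInt]
  | succ l ih =>
    rw [sum_range_succ, ih, ← qInt_add, ← card_union_of_disjoint]
    · congr 2; ext c; simp only [mem_union, mem_filter, mem_univ, true_and]; omega
    · rw [disjoint_left]; intro c; simp only [mem_filter]; omega

theorem sum_dinv_of_diag (l : ℕ) :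
    ∑ f : PrefFun (m + 1) with diag f = (fun c => (level τ c : ℤ) - l), q ^ dinv f =
      q ^ #{c | level τ c < l} * levelSum q label (fun c => (level τ c : ℤ) - l) univ := by
  rw [← sum_prefFun_diag_eq, mul_sum]
  refine sum_congr rfl fun f hf => ?_
  rw [dinv, tertiaryDinv_eq (mem_filter.1 hf).2, pow_add, mul_comm]

theorem filter_isParking_eq :
    (univ.filter fun f : PrefFun (m + 1) => IsParking f ∧ diagWord f = τ) =
      univ.filter fun f : PrefFun (m + 1) => diag f = fun c => (level τ c : ℤ) - (0 : ℕ) := by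
  ext f
  simp only [mem_filter, mem_univ, true_and]
  constructor
  · rintro ⟨hp, hf⟩
    obtain ⟨l, -, h⟩ := (diagWord_eq_iff τ f).1 hf
    rwa [(isParking_iff_eq_zero h).1 hp] at h
  · intro h
    exact ⟨(isParking_iff_eq_zero h).2 rfl, (diagWord_eq_iff τ f).2 ⟨0, by omega, h⟩⟩

/-- The identity of the main theorem without the quasi-symmetric functions. -/
theorem sum_dinv_diagWord (hq : ∀ m, 0 < m → qInt q m ≠ 0) :
    (∑ f : PrefFun (m + 1) with diagWord f = τ, q ^ dinv f) * qInt q (lastRunLength τ) =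
      qInt q (m + 1) * ∑ f : PrefFun (m + 1) with IsParking f ∧ diagWord f = τ, q ^ dinv f := by
  have hmaps : ∀ f ∈ (univ.filter fun f : PrefFun (m + 1) => diagWord f = τ),
      deviation f ∈ range (level τ (τ 0) + 1) := by
    intro f hf
    obtain ⟨l, hl, h⟩ := (diagWord_eq_iff τ f).1 (mem_filter.1 hf).2
    rw [deviation_eq h, mem_range]
    omega
  rw [← sum_fiberwise_of_maps_to hmaps, filter_isParking_eq, sum_dinv_of_diag, sum_mul,
    ← card_level_eq_zero]
  have hfib : ∀ l ∈ range (level τ (τ 0) + 1),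
      (∑ f ∈ (univ.filter fun f : PrefFun (m + 1) => diagWord f = τ) with deviation f = l,
        q ^ dinv f) * qInt q #{c | level τ c = 0} =
      (q ^ #{c | level τ c < l} * qInt q #{c | level τ c = l}) *
        levelSum q label (fun c => (level τ c : ℤ)) univ := by
    intro l hl
    rw [mem_range] at hl
    have he : (univ.filter fun f : PrefFun (m + 1) => diagWord f = τ).filter
        (fun f => deviation f = l) =
        (univ.filter fun f : PrefFun (m + 1) => diag f = fun c => (level τ c : ℤ) - l) := by
      ext f
      simp only [mem_filter, mem_univ, true_and]
      exact (diag_eq_iff f l (by omega)).symm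
    rw [he, sum_dinv_of_diag, mul_assoc, levelSum_level τ hq (by omega)]
    ring
  rw [sum_congr rfl hfib, ← sum_mul, sum_range_qInt_level]
  have : #{c | level τ c < level τ (τ 0) + 1} = m + 1 := by
    rw [filter_true_of_mem fun c _ => Nat.lt_succ_of_le (level_le τ c)]
    simp
  rw [this]
  simp

end Hilbert

/-! ### Blocks of consecutive labels on one level. -/

section Blocks

/-- The first element of the maximal interval around `c` on which `g` is constant. -/
noncomputable def block (g : Fin n → ℕ) (c : Fin n) : ℕ :=
  sInf {x : ℕ | ∀ z : Fin n, x ≤ z → z ≤ c → g z = g c}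

variable {g : Fin n → ℕ}

theorem block_le_of {c : Fin n} {x : ℕ} (h : ∀ z : Fin n, x ≤ z → z ≤ c → g z = g c) :
    block g c ≤ x := Nat.sInf_le h

theorem block_le (c : Fin n) : block g c ≤ c :=
  block_le_of fun z h1 h2 => by rw [le_antisymm h2 h1]

theorem eq_of_block_le {c z : Fin n} (h1 : block g c ≤ z) (h2 : z ≤ c) : g z = g c :=
  Nat.sInf_mem (s := {x : ℕ | ∀ z : Fin n, x ≤ z → z ≤ c → g z = g c})
    ⟨c, fun z h1 h2 => by rw [le_antisymm h2 h1]⟩ z h1 h2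

theorem monotone_block : Monotone (block g) := by
  intro x y hxy
  rcases le_or_gt (block g y) x with h | h
  · refine block_le_of fun z h1 h2 => ?_
    rw [eq_of_block_le h1 (h2.trans hxy), eq_of_block_le h hxy]
  · exact (block_le x).trans h.le

theorem eq_of_block_eq {x y : Fin n} (h : block g x = block g y) : g x = g y := by
  have hx := block_le (g := g) x
  have hy := block_le (g := g) y
  rw [← eq_of_block_le (g := g) (c := x) (z := ⟨block g x, by omega⟩) le_rfl hx,
    ← eq_of_block_le (g := g) (c := y) (z := ⟨block g x, by omega⟩) h.ge (h ▸ hy)]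

theorem block_eq_of_succ {x y : Fin n} (hxy : (y : ℕ) = x + 1) (h : g x = g y) :
    block g x = block g y := by
  refine le_antisymm (monotone_block (by omega)) (block_le_of fun z h1 h2 => ?_)
  rcases h2.eq_or_lt with rfl | h2
  · rfl
  · rw [← h, eq_of_block_le h1 (by omega)]

theorem lt_iff_of_block_ne {x y : Fin n} (h : block g x ≠ block g y) :
    x < y ↔ block g x < block g y := by
  constructor
  · exact fun hxy => lt_of_le_of_ne (monotone_block hxy.le) h
  · intro hxy
    by_contra! hle
    have := monotone_block (g := g) hle
    omega

/-- The permutations of the cars which preserve the maximal intervals on which `g` is constant. -/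
def blockPerms (g : Fin n → ℕ) : Subgroup (Equiv.Perm (Fin n)) where
  carrier := {π | ∀ c, block g (π c) = block g c}
  mul_mem' {π ρ} hπ hρ c := by rw [Equiv.Perm.mul_apply, hπ, hρ]
  one_mem' _ := rfl
  inv_mem' {π} hπ c := by rw [← hπ (π⁻¹ c)]; simp

end Blocks

/-! ### Permuting the cars within blocks. -/

section Action

/-- Cars in the same block lie in the same diagonal. -/
def Compatible (g : Fin n → ℕ) (f : PrefFun n) : Prop :=
  ∀ x y, block g x = block g y → diag f x = diag f y

variable {g : Fin n → ℕ} {f : PrefFun n}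

theorem eq_of_diag_eq {x y : Fin n} (h : diag f x = diag f y) (h' : f x = f y) : x = y := by
  refine row_injective f ?_
  simp only [diag, h'] at h
  omega

/-- Distinct cars of one diagonal lie in distinct columns. Labels are thus compared only between
different blocks, whose order `π` preserves. -/
theorem Compatible.row_comp (hf : Compatible g f) {π : Equiv.Perm (Fin n)}
    (hπ : π ∈ blockPerms g) (c : Fin n) : row (f ∘ π) c = row f (π c) := by
  refine card_nbij' π π.symm ?_ ?_ (by intro; simp) (by intro; simp)
  all_goals
    intro x
    have key : ∀ x, f (π x) = f (π c) → (x < c ↔ π x < π c) := by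
      intro x hx
      by_cases hxc : x = c
      · simp [hxc]
      · have h1 : block g (π x) ≠ block g (π c) := fun h =>
          hxc (π.injective (eq_of_diag_eq (hf _ _ h) hx))
        rw [lt_iff_of_block_ne h1, hπ, hπ, lt_iff_of_block_ne (by rwa [hπ, hπ] at h1)]
  · have := key x
    simp only [coe_filter, mem_univ, true_and, Set.mem_ofPred_eq, Function.comp]
    tauto
  · have := key (π.symm x)
    rw [Equiv.apply_symm_apply] at this
    simp only [coe_filter, mem_univ, true_and, Set.mem_ofPred_eq, Function.comp,
      Equiv.apply_symm_apply]
    tauto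

theorem Compatible.diag_comp (hf : Compatible g f) {π : Equiv.Perm (Fin n)}
    (hπ : π ∈ blockPerms g) (c : Fin n) : diag (f ∘ π) c = diag f (π c) := by
  rw [diag, hf.row_comp hπ, diag, Function.comp]

theorem Compatible.comp (hf : Compatible g f) {π : Equiv.Perm (Fin n)}
    (hπ : π ∈ blockPerms g) : Compatible g (f ∘ π) := fun x y h => by
  rw [hf.diag_comp hπ, hf.diag_comp hπ]
  exact hf _ _ (by rw [hπ, hπ, h])

/-- The diagonal inversions between cars of the same block. -/
noncomputable def blockDinv (g : Fin n → ℕ) (f : PrefFun n) : ℕ :=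
  #{p : Fin n × Fin n | p.1 < p.2 ∧ block g p.1 = block g p.2 ∧ f p.1 < f p.2}

/-- All other contributions to `dinv`. -/
noncomputable def outerDinv (g : Fin n → ℕ) (f : PrefFun n) : ℕ :=
  #{p : Fin n × Fin n | p.1 < p.2 ∧ block g p.1 ≠ block g p.2 ∧ diag f p.1 = diag f p.2 ∧
    f p.1 < f p.2} + secondaryDinv f + tertiaryDinv f

theorem Compatible.dinv_eq (hf : Compatible g f) : dinv f = outerDinv g f + blockDinv g f := by
  have : primaryDinv f = #{p : Fin n × Fin n | p.1 < p.2 ∧ block g p.1 ≠ block g p.2 ∧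
      diag f p.1 = diag f p.2 ∧ f p.1 < f p.2} + blockDinv g f := by
    rw [blockDinv, primaryDinv, ← card_union_of_disjoint]
    · congr 1
      ext p
      have := hf p.1 p.2
      simp only [mem_union, mem_filter, mem_univ, true_and]
      tauto
    · rw [disjoint_left]
      intro p
      simp only [mem_filter]
      tauto
  rw [dinv, this, outerDinv]
  ring

theorem card_filter_pair_comp (π : Equiv.Perm (Fin n)) (P Q : Fin n × Fin n → Prop)
    [DecidablePred P] [DecidablePred Q] (h : ∀ x y, P (x, y) ↔ Q (π x, π y)) :
    #{p | P p} = #{p | Q p} := by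
  refine card_nbij' (Prod.map π π) (Prod.map π.symm π.symm) ?_ ?_ (by rintro ⟨x, y⟩ _; simp)
    (by rintro ⟨x, y⟩ _; simp)
  · rintro ⟨x, y⟩
    simpa using (h x y).1
  · rintro ⟨x, y⟩
    simpa using (h (π.symm x) (π.symm y)).2

theorem Compatible.outerDinv_comp (hf : Compatible g f) {π : Equiv.Perm (Fin n)}
    (hπ : π ∈ blockPerms g) : outerDinv g (f ∘ π) = outerDinv g f := by
  have hlt : ∀ x y, block g x ≠ block g y → (x < y ↔ π x < π y) := by
    intro x y h
    rw [lt_iff_of_block_ne h, lt_iff_of_block_ne (by rwa [hπ, hπ]), hπ, hπ]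
  rw [outerDinv, outerDinv, secondaryDinv, secondaryDinv, tertiaryDinv, tertiaryDinv]
  congr 1
  · congr 1
    · refine card_filter_pair_comp π _ _ fun x y => ?_
      simp only [hf.diag_comp hπ, Function.comp, hπ _]
      by_cases h : block g x = block g y
      · simp [h]
      · rw [hlt x y h]
    · refine card_filter_pair_comp π _ _ fun x y => ?_
      simp only [hf.diag_comp hπ, Function.comp]
      by_cases h : block g x = block g y
      · have := hf (π x) (π y) (by rw [hπ, hπ, h])
        simp [this]
      · rw [hlt x y h]
  · refine card_nbij' π π.symm ?_ ?_ (by intro; simp) (by intro; simp)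
    · intro c
      simp [hf.diag_comp hπ]
    · intro c
      simp [hf.diag_comp hπ]

/-- Within each block, `f` and `f'` arrange the cars in the same order. -/
def SamePattern (g : Fin n → ℕ) (f f' : PrefFun n) : Prop :=
  ∀ x y, block g x = block g y → (f x < f y ↔ f' x < f' y)

theorem SamePattern.comp {f' : PrefFun n} (h : SamePattern g f f') {π : Equiv.Perm (Fin n)}
    (hπ : π ∈ blockPerms g) : SamePattern g (f ∘ π) (f' ∘ π) := fun x y hxy =>
  h _ _ (by rw [hπ, hπ, hxy])

theorem SamePattern.blockDinv_eq {f' : PrefFun n} (h : SamePattern g f f') :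
    blockDinv g f = blockDinv g f' := by
  unfold blockDinv
  congr 1
  ext p
  have := h p.1 p.2
  simp only [mem_filter, mem_univ, true_and]
  tauto

theorem word_symm_lt_iff (f : PrefFun n) (x y : Fin n) : (word f).symm x < (word f).symm y ↔
    diag f y < diag f x ∨ (diag f x = diag f y ∧ f y < f x) := by
  have hinj : Function.Injective fun c : Fin n => toLex (-diag f c, -((f c : ℕ) : ℤ)) := by
    intro x y h
    simp only [EmbeddingLike.apply_eq_iff_eq, Prod.mk.injEq, neg_inj] at h
    exact eq_of_diag_eq h.1 (by omega)
  have hmono : StrictMono ((fun c : Fin n => toLex (-diag f c, -((f c : ℕ) : ℤ))) ∘ word f) :=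
    (Tuple.monotone_sort _).strictMono_of_injective (hinj.comp (word f).injective)
  rw [← hmono.lt_iff_lt]
  simp only [Function.comp, Equiv.apply_symm_apply, Prod.Lex.toLex_lt_toLex]
  omega

/-- Labels `i` and `i + 1` on different levels are ordered by the levels; on the same level they
share a block and are ordered by the pattern. -/
theorem SamePattern.ides_eq {f' : PrefFun n} (h : SamePattern g f f') {l l' : ℕ}
    (hf : diag f = fun c => (g c : ℤ) - l) (hf' : diag f' = fun c => (g c : ℤ) - l') :
    ides f = ides f' := by
  ext i
  simp only [ides, invDescents, mem_filter, mem_univ, true_and, word_symm_lt_iff, hf, hf']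
  refine exists_congr fun hi => ?_
  have h1 := h i ⟨i + 1, hi⟩
  have h2 := block_eq_of_succ (g := g) (x := i) (y := ⟨i + 1, hi⟩) rfl
  by_cases he : g i = g ⟨i + 1, hi⟩
  · have := h1 (h2 he)
    omega
  · omega

theorem compatible_of_diag {l : ℕ} (hf : diag f = fun c => (g c : ℤ) - l) : Compatible g f :=
  fun x y h => by rw [hf]; simp only [eq_of_block_eq h]

/-- Sort the cars by block and then by column, for `f` and for `f'`. The two lists run through the
blocks in the same way, so matching them entry by entry preserves blocks. -/
theorem Compatible.exists_samePattern {f' : PrefFun n} (hf : Compatible g f)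
    (hf' : Compatible g f') : ∃ π ∈ blockPerms g, SamePattern g (f ∘ π) f' := by
  have key : ∀ f : PrefFun n, Compatible g f → ∃ s : Equiv.Perm (Fin n),
      Monotone (block g ∘ s) ∧
      ∀ i j, block g (s i) = block g (s j) → (f (s i) < f (s j) ↔ i < j) := by
    intro f hf
    have hinj : Function.Injective fun c : Fin n => toLex (block g c, f c) := by
      intro x y h
      simp only [EmbeddingLike.apply_eq_iff_eq, Prod.mk.injEq] at h
      exact eq_of_diag_eq (hf _ _ h.1) h.2
    let s := Tuple.sort fun c : Fin n => toLex (block g c, f c)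
    have hmono : StrictMono ((fun c : Fin n => toLex (block g c, f c)) ∘ s) :=
      (Tuple.monotone_sort _).strictMono_of_injective (hinj.comp s.injective)
    refine ⟨s, fun i j hij => ?_, fun i j h => ?_⟩
    · have := hmono.monotone hij
      simp only [Function.comp, Prod.Lex.toLex_le_toLex] at this ⊢
      omega
    · rw [← hmono.lt_iff_lt (a := i) (b := j)]
      simp only [Function.comp, Prod.Lex.toLex_lt_toLex]
      omega
  obtain ⟨s, hs, hs'⟩ := key f hf
  obtain ⟨r, hr, hr'⟩ := key f' hf'
  have hsr := Tuple.unique_monotone hs hr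
  have hmem : ∀ c, block g (s (r.symm c)) = block g c := fun c => by
    have := congrFun hsr (r.symm c)
    simpa using this
  refine ⟨r.symm.trans s, hmem, fun x y h => ?_⟩
  have h1 := hs' (r.symm x) (r.symm y) (by rw [hmem, hmem, h])
  have h2 := hr' (r.symm x) (r.symm y) (by simpa using h)
  rw [Equiv.apply_symm_apply, Equiv.apply_symm_apply] at h2
  rw [h2, ← h1]
  rfl

end Action

/-! ### Averaging over the block permutations. -/

section Averaging

variable {R : Type*} [CommRing R] {g : Fin n → ℕ}

open Classical in
theorem sum_blockPerms_mul [IsDomain R] (q : R) (hq : q ≠ 0) (Q : Finset (Fin n) → R)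
    {f f' : PrefFun n} {l l' : ℕ} (hf : diag f = fun c => (g c : ℤ) - l) (hf' : diag f' = fun c => (g c : ℤ) - l') :
    (∑ π : blockPerms g, q ^ dinv (f ∘ π.1) * Q (ides (f ∘ π.1))) *
        ∑ π : blockPerms g, q ^ dinv (f' ∘ π.1) =
      (∑ π : blockPerms g, q ^ dinv (f ∘ π.1)) *
        ∑ π : blockPerms g, q ^ dinv (f' ∘ π.1) * Q (ides (f' ∘ π.1)) := by
  have hd : ∀ {f : PrefFun n} {l : ℕ}, diag f = (fun c => (g c : ℤ) - l) →
      ∀ π ∈ blockPerms g, diag (f ∘ π) = fun c => (g c : ℤ) - l := by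
    intro f l hf π hπ
    funext c
    rw [(compatible_of_diag hf).diag_comp hπ, hf]
    simp only [eq_of_block_eq (hπ c)]
  have cf := compatible_of_diag hf
  have cf' := compatible_of_diag hf'
  obtain ⟨ρ, hρ, hpat⟩ := cf.exists_samePattern cf'
  -- After translation by `ρ` the two sums differ only by the inversions between blocks, which are
  -- constant on each orbit. Taking `P = Q` and `P = 1` and eliminating these powers of `q` gives
  -- the claim.
  have hsum : ∀ P : Finset (Fin n) → R,
      (∑ π : blockPerms g, q ^ dinv (f ∘ π.1) * P (ides (f ∘ π.1))) * q ^ outerDinv g f' =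
      (∑ π : blockPerms g, q ^ dinv (f' ∘ π.1) * P (ides (f' ∘ π.1))) * q ^ outerDinv g f := by
    intro P
    rw [← Equiv.sum_comp (Equiv.mulLeft (⟨ρ, hρ⟩ : blockPerms g)), sum_mul, sum_mul]
    refine sum_congr rfl fun π _ => ?_
    have hπ := π.2
    have e1 : f ∘ ((Equiv.mulLeft (⟨ρ, hρ⟩ : blockPerms g) π).1) = (f ∘ ρ) ∘ π.1 := rfl
    have hp := hpat.comp hπ
    rw [e1, hp.ides_eq (hd (hd hf ρ hρ) _ hπ) (hd hf' _ hπ), ((cf.comp hρ).comp hπ).dinv_eq,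
      (cf'.comp hπ).dinv_eq, hp.blockDinv_eq, (cf.comp hρ).outerDinv_comp hπ,
      cf.outerDinv_comp hρ, cf'.outerDinv_comp hπ]
    ring
  have h1 := hsum Q
  have h2 := hsum fun _ => 1
  simp only [mul_one] at h2
  refine mul_right_cancel₀ (mul_ne_zero (pow_ne_zero (outerDinv g f') hq)
    (pow_ne_zero (outerDinv g f) hq)) ?_
  linear_combination q ^ outerDinv g f * (∑ π : blockPerms g, q ^ dinv (f' ∘ π.1)) * h1 -
    q ^ outerDinv g f * (∑ π : blockPerms g, q ^ dinv (f' ∘ π.1) * Q (ides (f' ∘ π.1))) * h2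

open Classical in
theorem sum_sum_blockPerms (F : PrefFun n → R) (X : Finset (PrefFun n))
    (hX : ∀ f ∈ X, ∀ π ∈ blockPerms g, f ∘ π ∈ X) :
    ∑ f ∈ X, ∑ π : blockPerms g, F (f ∘ π.1) =
      (Fintype.card (blockPerms g) : R) * ∑ f ∈ X, F f := by
  rw [sum_comm, ← nsmul_eq_mul, ← card_univ, ← sum_const]
  refine sum_congr rfl fun π _ => ?_
  refine sum_nbij' (fun f => f ∘ π.1) (fun f => f ∘ π.1.symm) (fun f hf => hX f hf _ π.2)
    (fun f hf => hX f hf _ ((blockPerms g).inv_mem π.2)) ?_ ?_ fun _ _ => rfl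
  · intro f _; funext c; simp
  · intro f _; funext c; simp

/-- For two families of preference functions with the same levels which are closed under the
permutations of the blocks, the sums weighted by a function of the inverse descent set are
proportional to the unweighted sums. -/
theorem sum_mul_sum_comm [IsDomain R] [CharZero R] (q : R) (hq : q ≠ 0) (Q : Finset (Fin n) → R)
    (X Y : Finset (PrefFun n))
    (hX : ∀ f ∈ X, ∃ l : ℕ, diag f = fun c => (g c : ℤ) - l)
    (hY : ∀ f ∈ Y, ∃ l : ℕ, diag f = fun c => (g c : ℤ) - l)
    (hX' : ∀ f ∈ X, ∀ π ∈ blockPerms g, f ∘ π ∈ X)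
    (hY' : ∀ f ∈ Y, ∀ π ∈ blockPerms g, f ∘ π ∈ Y) :
    (∑ f ∈ X, q ^ dinv f * Q (ides f)) * ∑ f ∈ Y, q ^ dinv f =
      (∑ f ∈ X, q ^ dinv f) * ∑ f ∈ Y, q ^ dinv f * Q (ides f) := by
  classical
  have hW : (Fintype.card (blockPerms g) : R) ≠ 0 := Nat.cast_ne_zero.2 Fintype.card_ne_zero
  refine mul_left_cancel₀ (mul_ne_zero hW hW) ?_
  have h1 := sum_sum_blockPerms (fun f => q ^ dinv f * Q (ides f)) X hX'
  have h2 := sum_sum_blockPerms (fun f => q ^ dinv f) X hX'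
  have h3 := sum_sum_blockPerms (fun f => q ^ dinv f * Q (ides f)) Y hY'
  have h4 := sum_sum_blockPerms (fun f => q ^ dinv f) Y hY'
  have key := congrArg₂ (· * ·) h1 h4
  have key' := congrArg₂ (· * ·) h2 h3
  simp only [sum_mul_sum] at key key'
  have h : ∀ f ∈ X, ∀ f' ∈ Y, _ := fun f hf f' hf' =>
    sum_blockPerms_mul q hq Q (hX f hf).choose_spec (hY f' hf').choose_spec
  simp only [sum_mul_sum] at h
  rw [sum_congr rfl fun f hf => sum_congr rfl (h f hf), key'] at key
  linear_combination -key

end Averaging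

/-- Specialising `q` to 1 gives the number of summands, which is nonzero in characteristic zero. -/
theorem sum_pow_q_ne_zero {ι : Type*} {s : Finset ι} (hs : s.Nonempty) (e : ι → ℕ) :
    ∑ i ∈ s, q ^ e i ≠ 0 := by
  intro h
  simp only [q, ← map_pow, ← map_sum] at h
  have h1 := (IsFractionRing.to_map_eq_zero_iff (K := RatQT)).1 h
  have h2 := congrArg (MvPolynomial.eval fun _ => (1 : ℚ)) h1
  simp at h2
  exact hs.ne_empty h2

theorem qInt_q_ne_zero (m : ℕ) (hm : 0 < m) : qInt q m ≠ 0 :=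
  sum_pow_q_ne_zero (nonempty_range_iff.2 hm.ne') _

end SquarePaths

open SquarePaths in
theorem mainTheorem3 (n : ℕ) (hn : 1 ≤ n) (τ : Equiv.Perm (Fin n)) :
    ∑ f : SquarePaths.PrefFun n with SquarePaths.diagWord f = τ, SquarePaths.term f =
      MvPolynomial.C (SquarePaths.qInt SquarePaths.q n /
          SquarePaths.qInt SquarePaths.q (SquarePaths.lastRunLength τ)) *
        ∑ f : SquarePaths.PrefFun n with
          SquarePaths.IsParking f ∧ SquarePaths.diagWord f = τ, SquarePaths.term f := by
  obtain ⟨m, rfl⟩ := Nat.exists_eq_add_of_le' hn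
  set X := univ.filter fun f : PrefFun (m + 1) => diagWord f = τ with hXdef
  set Y := univ.filter fun f : PrefFun (m + 1) => IsParking f ∧ diagWord f = τ with hYdef
  have hYX : Y ⊆ X := fun f => by simp +contextual [X, Y]
  have hX : ∀ f ∈ X, ∃ l : ℕ, diag f = fun c => (level τ c : ℤ) - l := fun f hf => by
    obtain ⟨l, -, h⟩ := (diagWord_eq_iff τ f).1 (mem_filter.1 hf).2
    exact ⟨l, h⟩
  have hY := fun f hf => hX f (hYX hf)
  have hcomp : ∀ (f : PrefFun (m + 1)) (l : ℕ), diag f = (fun c => (level τ c : ℤ) - l) →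
      ∀ π ∈ blockPerms (level τ), diag (f ∘ π) = diag f := by
    intro f l hf π hπ
    funext c
    rw [(compatible_of_diag hf).diag_comp hπ, hf]
    simp only [eq_of_block_eq (hπ c)]
  have hX' : ∀ f ∈ X, ∀ π ∈ blockPerms (level τ), f ∘ π ∈ X := by
    intro f hf π hπ
    obtain ⟨l, hl⟩ := hX f hf
    simp only [X, mem_filter, mem_univ, true_and, diagWord_eq_iff] at hf ⊢
    rwa [hcomp f l hl π hπ]
  have hY' : ∀ f ∈ Y, ∀ π ∈ blockPerms (level τ), f ∘ π ∈ Y := by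
    intro f hf π hπ
    obtain ⟨l, hl⟩ := hY f hf
    simp only [Y, mem_filter, mem_univ, true_and, diagWord_eq_iff, isParking_iff] at hf ⊢
    rwa [hcomp f l hl π hπ]
  have hk : qInt q (lastRunLength τ) ≠ 0 := by
    rw [← card_level_eq_zero]
    exact qInt_q_ne_zero _ (card_pos.2 ⟨_, by simpa using level_last τ⟩)
  have hilbert := sum_dinv_diagWord τ qInt_q_ne_zero
  rw [← hXdef, ← hYdef] at hilbert
  have hterm : ∀ Z ⊆ X, ∑ f ∈ Z, term f = MvPolynomial.C (t ^ ∑ c, level τ c) *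
      ∑ f ∈ Z, MvPolynomial.C q ^ dinv f * fundamentalQSym RatQT (ides f) := by
    intro Z hZ
    rw [mul_sum]
    refine sum_congr rfl fun f hf => ?_
    obtain ⟨l, hl⟩ := hX f (hZ hf)
    rw [term, area_eq hl, map_mul, map_pow, mul_assoc]
    simp only [map_pow]
  have hC : ∀ Z : Finset (PrefFun (m + 1)), ∑ f ∈ Z,
      (MvPolynomial.C q : MvPolynomial (Fin (m + 1)) RatQT) ^ dinv f =
        MvPolynomial.C (∑ f ∈ Z, q ^ dinv f) := fun Z => by
    simp only [map_sum, map_pow]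
  have hq0 : (MvPolynomial.C q : MvPolynomial (Fin (m + 1)) RatQT) ≠ 0 := by
    rw [Ne, MvPolynomial.C_eq_zero]
    simpa using sum_pow_q_ne_zero (singleton_nonempty ()) fun _ => 1
  rw [hterm X subset_rfl, hterm Y hYX]
  -- The parking sum will be cancelled, so it has to be nonzero. If there were no parking functions,
  -- the identity of `q`-counts would leave no preference functions either.
  rcases Y.eq_empty_or_nonempty with hYe | hYn
  · rcases X.eq_empty_or_nonempty with hXe | hXn
    · simp [hXe, hYe]
    · rw [hYe, sum_empty, mul_zero] at hilbert
      exact absurd hilbert (mul_ne_zero (sum_pow_q_ne_zero hXn _) hk)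
  · have key := sum_mul_sum_comm (MvPolynomial.C q) hq0 (fundamentalQSym RatQT) X Y hX hY hX' hY'
    rw [hC, hC] at key
    have hh : ∑ f ∈ X, q ^ dinv f = qInt q (m + 1) / qInt q (lastRunLength τ) *
        ∑ f ∈ Y, q ^ dinv f := by
      rw [div_mul_eq_mul_div, eq_div_iff hk, hilbert]
    rw [hh, MvPolynomial.C_mul] at key
    have hY0 : (MvPolynomial.C (∑ f ∈ Y, q ^ dinv f) : MvPolynomial (Fin (m + 1)) RatQT) ≠ 0 := by
      rw [Ne, MvPolynomial.C_eq_zero]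
      exact sum_pow_q_ne_zero hYn _
    refine mul_right_cancel₀ hY0 ?_
    linear_combination MvPolynomial.C (t ^ ∑ c, level τ c) * key
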